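/- Let $X$ be a closed connected Riemann surface with a finite non-empty set of punctures removed, and let $\pi\colon\mathbb H\to X$ be a holomorphic universal covering; $X$ carries the complete hyperbolic metric induced by $\pi$. A *geodesic ideal arc* on $X$ is the image under $\pi$ of a bi-infinite geodesic $\ell\subset\mathbb H$ such that $\pi$ tends to a puncture along each of the two ends of $\ell$; let $\mathcal L$ be the set of all such lines $\ell$, and let $\mathcal P$ be the set of the half-planes bounded by them, i.e. of the connected components of $\mathbb H\setminus\ell$, $\ell\in\mathcal L$. *Construction.* Let $\mathbf e=\{e_1,\dots,e_k\}$ be a finite family of simple, pairwise disjoint geodesic ideal arcs such that $X\setminus\bigcup_i e_i$ is a simply connected domain (then $k=2g+n-1$ if $X$ has genus $g$ and $n$ punctures). Let $p\in X\setminus\bigcup_i e_i$ be a basepoint and $\tilde p\in\pi^{-1}(p)$ a lift of it. Products of loops are read from left to right, and $\gamma\in\pi_1(X,p)$ acts on $\mathbb H$ by the deck transformation that maps $\tilde p$ to the endpoint of the lift of $\gamma$ starting at $\tilde p$. Let $\gamma_i\in\pi_1(X,p)$ be the class, unique up to inversion, of a loop that crosses $e_i$ exactly once and meets $\bigcup_j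 e_j$ nowhere else. Let $G_{\mathbf e}$ be the Cayley graph of $\pi_1(X,p)$ with respect to $\{\gamma_1,\dots,\gamma_k\}$ (vertices $\gamma$, edges joining $\gamma$ to $\gamma\gamma_i$), as a metric graph with edges of length $1$. Its Gromov boundary $\partial_\infty G_{\mathbf e}$ is the set of geodesic rays $r\colon[0,\infty)\to G_{\mathbf e}$ modulo staying at bounded distance, $\sup_t d(r(t),r'(t))<\infty$. Let $\iota\colon G_{\mathbf e}\hookrightarrow\mathbb H$ be a $\pi_1(X,p)$-equivariant topological embedding. The set $\widehat{\mathbb H}=\mathbb H\sqcup\partial_\infty G_{\mathbf e}$ is given the topology generated by the open subsets of $\mathbb H$ and the sets $$U_P=P\cup\{[r]\in\partial_\infty G_{\mathbf e}\mid \exists\,T>0\ \forall\,t>T:\ \iota(r(t))\in P\},\qquad P\in\mathcal P .$$ *Change of choices.* Let $(\mathbf e_j,p_j,\tilde p_j,\iota_j)$, $j=1,2$, be two such choices for the same $\pi$, with resulting spaces $\widehat{\mathbb H}_j=\mathbb H\sqcup\partial_\infty G_{\mathbf e_j}$. Let $c$ be a path in $X$ from $p_1$ to $p_2$ whose lift starting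 at $\tilde p_1$ ends at $\tilde p_2$, and let $\beta_c\colon\pi_1(X,p_1)\to\pi_1(X,p_2)$, $[\gamma]\mapsto[c^{-1}\cdot\gamma\cdot c]$, be the change-of-basepoint isomorphism. Let $f\colon G_{\mathbf e_1}\to G_{\mathbf e_2}$ be the extension of $\beta_c$ that maps each edge at constant speed onto a geodesic segment. **Proposition 4.1.** The quasi-isometry $f$ induces a map $\partial f\colon\partial_\infty G_{\mathbf e_1}\to\partial_\infty G_{\mathbf e_2}$, characterized by: for all geodesic rays $r$ in $G_{\mathbf e_1}$ and $r'$ in $G_{\mathbf e_2}$, $\partial f([r])=[r']$ if and only if the images of $f\circ r$ and of $r'$ are at finite Hausdorff distance. The map $\mathcal I\colon\widehat{\mathbb H}_1\to\widehat{\mathbb H}_2$ which is the identity on $\mathbb H$ and $\partial f$ on $\partial_\infty G_{\mathbf e_1}$ is a homeomorphism. In particular, the topology does not depend on the choices of $\mathbf e$, $p$ and $\iota$. -/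

import Mathlib

open Set Filter Topology
open scoped Manifold ContDiff UpperHalfPlane NNReal unitInterval

noncomputable section

namespace IdealBoundary

section MetricGraph

variable {V W : Type*}

open Classical in
/-- The point at distance `t` from `u` on the unit interval joining `u` to `v`, in barycentric
coordinates on the vertex set. For `u = v` it is the vertex `u` itself. -/
def edgeFun (u v : V) (t : ℝ) : V → ℝ :=
  (1 - t) • Pi.single u (1 : ℝ) + t • Pi.single v (1 : ℝ)

/-- The metric graph (geometric realization) of a simple graph: each vertex is a point and each
edge a unit interval. A point is recorded by its barycentric coordinates. -/
def Realization (G : SimpleGraph V) : Type _ :=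
  {x : V → ℝ // ∃ u v, (u = v ∨ G.Adj u v) ∧ ∃ t ∈ Icc (0 : ℝ) 1, x = edgeFun u v t}

/-- Coordinatewise convergence. This is the topology of the path metric: a neighbourhood of a
vertex `u` is given by `x u > 1 - ε`, and a point close to an interior point of an edge has positive
coordinates at both ends of that edge, hence lies on it. -/
instance (G : SimpleGraph V) : TopologicalSpace (Realization G) :=
  inferInstanceAs (TopologicalSpace {x : V → ℝ //
    ∃ u v, (u = v ∨ G.Adj u v) ∧ ∃ t ∈ Icc (0 : ℝ) 1, x = edgeFun u v t})

/-- A vertex, as a point of the metric graph. -/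
def vertex (G : SimpleGraph V) (u : V) : Realization G :=
  ⟨edgeFun u u 0, u, u, Or.inl rfl, 0, by simp, rfl⟩

/-- The point at distance `t` from `u` on the edge from `u` to `v`. -/
def edgePoint {G : SimpleGraph V} {u v : V} (h : G.Adj u v) (t : Icc (0 : ℝ) 1) :
    Realization G :=
  ⟨edgeFun u v t, u, v, Or.inr h, t, t.2, rfl⟩

/-- The path metric of a connected metric graph whose edges have length one. A shortest path from
`x` to `y` either stays inside one edge, or leaves the edge of `x` at an endpoint `u`, runs through
the graph to a vertex `w`, and enters the edge of `y` at its endpoint `w`. On vertices this is the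
combinatorial graph distance (for a Cayley graph, the word metric). -/
def pathDist {G : SimpleGraph V} (x y : Realization G) : ℝ :=
  sInf ({L : ℝ | (∃ u v, G.Adj u v ∧ Function.support x.1 ⊆ {u, v} ∧
            Function.support y.1 ⊆ {u, v}) ∧ L = ⨆ v, |x.1 v - y.1 v|} ∪
        {L : ℝ | ∃ u w, 0 < x.1 u ∧ 0 < y.1 w ∧
            L = (1 - x.1 u) + (G.dist u w : ℝ) + (1 - y.1 w)})

/-- Geodesic rays `[0, ∞) → G` (with arbitrary starting point). -/
structure GeodesicRay (G : SimpleGraph V) where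
  toFun : ℝ≥0 → Realization G
  pathDist_eq : ∀ s t, pathDist (toFun s) (toFun t) = |(s : ℝ) - t|

/-- Two rays are equivalent if they stay at bounded distance. -/
def Asymptotic {G : SimpleGraph V} (r r' : GeodesicRay G) : Prop :=
  ∃ C : ℝ, ∀ t, pathDist (r.toFun t) (r'.toFun t) ≤ C

/-- The Gromov boundary: classes of asymptotic geodesic rays (being asymptotic is an equivalence
relation because `pathDist` is a metric for a connected graph). -/
def GromovBoundary (G : SimpleGraph V) : Type _ := Quot (Asymptotic (G := G))

/-- The class of a ray. -/
def GeodesicRay.class {G : SimpleGraph V} (r : GeodesicRay G) : GromovBoundary G :=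
  Quot.mk _ r

/-- `f` extends the vertex map `β` and sends each edge at constant speed to a geodesic segment. -/
def IsGeodesicExtension {G : SimpleGraph V} {H : SimpleGraph W} (β : V → W)
    (f : Realization G → Realization H) : Prop :=
  (∀ u, f (vertex G u) = vertex H (β u)) ∧
  ∀ (u v : V) (h : G.Adj u v) (s t : Icc (0 : ℝ) 1),
    pathDist (f (edgePoint h s)) (f (edgePoint h t)) = |(s : ℝ) - t| * (H.dist (β u) (β v) : ℝ)

/-- `b` is the boundary map `∂f` of the quasi-isometry `f`: the image of the class of a ray `r`
is the class of the geodesic rays at finite Hausdorff distance from `f ∘ r`. This property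
determines `b`. -/
def IsBoundaryMap {G : SimpleGraph V} {H : SimpleGraph W} (f : Realization G → Realization H)
    (b : GromovBoundary G → GromovBoundary H) : Prop :=
  ∀ (r : GeodesicRay G) (r' : GeodesicRay H), b r.class = r'.class ↔
    ∃ C : ℝ, (∀ t, ∃ s, pathDist (f (r.toFun t)) (r'.toFun s) ≤ C) ∧
      ∀ s, ∃ t, pathDist (f (r.toFun t)) (r'.toFun s) ≤ C

end MetricGraph

section CayleyGraph

/-- The fundamental group with the product `γ * δ` = first `γ`, then `δ`; Mathlib's own product
on `FundamentalGroup` is the opposite one. -/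
abbrev LoopGroup (X : Type*) [TopologicalSpace X] (p : X) : Type _ := (FundamentalGroup X p)ᵐᵒᵖ

/-- The class of a loop. -/
def loopClass {X : Type*} [TopologicalSpace X] {p : X} (α : Path p p) : LoopGroup X p :=
  MulOpposite.op (FundamentalGroup.fromPath (Path.Homotopic.Quotient.mk α))

/-- Change of basepoint along a path `c` from `p` to `q`: a loop `γ` at `p` goes to the loop
"`c` backwards, then `γ`, then `c`" at `q`. -/
def changeBasepoint {X : Type*} [TopologicalSpace X] {p q : X} (c : Path p q) :
    LoopGroup X p ≃* LoopGroup X q :=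
  MulEquiv.op (FundamentalGroup.fundamentalGroupMulEquivOfPath c)

/-- Left translation by `h` on the metric Cayley graph with respect to `s`; it maps the vertex `u`
to the vertex `h * u`. -/
def translate {Γ : Type*} [Group Γ] {s : Set Γ} (h : Γ)
    (x : Realization (SimpleGraph.mulCayley s)) : Realization (SimpleGraph.mulCayley s) :=
  ⟨fun v => x.1 (h⁻¹ * v), by
    obtain ⟨x, u, v, huv, t, ht, rfl⟩ := x
    refine ⟨h * u, h * v, ?_, t, ht, ?_⟩
    · rcases huv with rfl | huv
      · exact Or.inl rfl
      · right
        rw [SimpleGraph.mulCayley_adj'] at huv ⊢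
        obtain ⟨hne, g, hg, hg'⟩ := huv
        refine ⟨fun h' => hne (mul_left_cancel h'), g, hg, ?_⟩
        rcases hg' with rfl | rfl
        · exact Or.inl (mul_assoc _ _ _)
        · exact Or.inr (mul_assoc _ _ _).symm
    · funext w
      have key : ∀ a : Γ, h⁻¹ * w = a ↔ w = h * a := fun a => inv_mul_eq_iff_eq_mul
      have hu := key u
      have hv := key v
      simp only [edgeFun, Pi.add_apply, Pi.smul_apply, Pi.single_apply]
      split_ifs <;> first | rfl | tauto⟩

end CayleyGraph

section Surface

variable {Y : Type*} [TopologicalSpace Y] {S : Set Y}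

/-- A unit speed parametrization `c` of a bi-infinite geodesic of `ℍ` whose image in the surface
`Sᶜ` is a geodesic ideal arc: at both ends it tends to a puncture (a point of `S`). -/
def IsIdealGeodesic (π : C(ℍ, (Sᶜ : Set Y))) (c : ℝ → ℍ) : Prop :=
  Isometry c ∧ (∃ q ∈ S, Tendsto (fun t => (π (c t) : Y)) atTop (𝓝 q)) ∧
    ∃ q ∈ S, Tendsto (fun t => (π (c t) : Y)) atBot (𝓝 q)

/-- The lifts to `ℍ` of the geodesic ideal arcs of the surface. -/
def idealLines (π : C(ℍ, (Sᶜ : Set Y))) : Set (Set ℍ) :=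
  {l | ∃ c, IsIdealGeodesic π c ∧ range c = l}

/-- The half-planes bounded by lifts of geodesic ideal arcs. -/
def halfPlanes (π : C(ℍ, (Sᶜ : Set Y))) : Set (Set ℍ) :=
  {P | ∃ l ∈ idealLines π, ∃ x ∈ lᶜ, P = connectedComponentIn lᶜ x}

/-- A cutting system: finitely many simple, pairwise disjoint geodesic ideal arcs in the surface
such that the complement of their union is a simply connected domain, together with a point `z` of
`ℍ` lying over the complement; `π z` is the basepoint, and `z` is its chosen lift. -/
structure CutSystem (π : C(ℍ, (Sᶜ : Set Y))) where
  k : ℕ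
  arc : Fin k → Set (Sᶜ : Set Y)
  isArc : ∀ i, ∃ c, IsIdealGeodesic π c ∧ Function.Injective (fun t => π (c t)) ∧
    range (fun t => π (c t)) = arc i
  disjoint : Pairwise fun i j => Disjoint (arc i) (arc j)
  simplyConnected : SimplyConnectedSpace ((⋃ i, arc i)ᶜ : Set (Sᶜ : Set Y))
  z : ℍ
  notMem : π z ∉ ⋃ i, arc i

namespace CutSystem

variable {π : C(ℍ, (Sᶜ : Set Y))}

/-- The fundamental group of the surface at the basepoint. -/
abbrev group (E : CutSystem π) : Type _ := LoopGroup (Sᶜ : Set Y) (π E.z)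

/-- A path in `ℍ` from `z` to a point over the basepoint projects to a loop; this is its class. -/
def projClass (E : CutSystem π) {w : ℍ} (h : π w = π E.z) (α : Path E.z w) : E.group :=
  loopClass ((α.map π.continuous).cast rfl h.symm)

/-- `γ` is the class of a loop at the basepoint that meets the union of the arcs at exactly one
time `t`, at a point of the `i`-th arc, and crosses that arc there: the lift `α` of the loop starts
and ends on different sides of the lift `l` of the arc that it meets. Such a class is
determined by `i` up to inversion, that is, up to the direction of the crossing. -/
def IsDual (E : CutSystem π) (i : Fin E.k) (γ : E.group) : Prop :=
  ∃ (w : ℍ) (h : π w = π E.z) (α : Path E.z w) (t : I) (l : Set ℍ),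
    E.projClass h α = γ ∧ l ∈ idealLines π ∧ π '' l = E.arc i ∧ α t ∈ l ∧
    (∀ s, π (α s) ∈ ⋃ j, E.arc j ↔ s = t) ∧ w ∉ connectedComponentIn lᶜ E.z

/-- The Cayley graph of the fundamental group with respect to the dual loops of the arcs (and their
inverses, which contribute the same edges). -/
def cayley (E : CutSystem π) : SimpleGraph E.group :=
  SimpleGraph.mulCayley {γ | ∃ i, E.IsDual i γ}

/-- `φ` is the deck transformation through which `γ` acts on `ℍ`: it maps the chosen lift `z` of
the basepoint to the endpoint of the lift of `γ` starting at `z`. -/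
def IsDeck (E : CutSystem π) (γ : E.group) (φ : ℍ ≃ₜ ℍ) : Prop :=
  ∃ h : ∀ w, π (φ w) = π w, ∃ α : Path E.z (φ E.z), E.projClass (h E.z) α = γ

/-- `ι` is an embedding of the metric Cayley graph in `ℍ`, equivariant under the fundamental
group. -/
def IsEquivariantEmbedding (E : CutSystem π) (ι : Realization E.cayley → ℍ) : Prop :=
  IsEmbedding ι ∧
    ∀ (γ : E.group) (φ : ℍ ≃ₜ ℍ), E.IsDeck γ φ → ∀ x, ι (translate γ x) = φ (ι x)

/-- The set `ℍ ⊔ ∂G`. The embedding `ι` only enters its topology. -/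
def Hat (E : CutSystem π) (_ι : Realization E.cayley → ℍ) : Type _ :=
  ℍ ⊕ GromovBoundary E.cayley

variable {E : CutSystem π} {ι : Realization E.cayley → ℍ}

/-- The set `U_P`: the half-plane `P` and the boundary points `[r]` for which `ι ∘ r` is
eventually in `P`. -/
def halfPlaneNhd (E : CutSystem π) (ι : Realization E.cayley → ℍ) (P : Set ℍ) : Set (E.Hat ι) :=
  Sum.inl '' P ∪ Sum.inr '' {ξ | ∃ r : GeodesicRay E.cayley, r.class = ξ ∧
    ∃ T : ℝ≥0, 0 < T ∧ ∀ t, T < t → ι (r.toFun t) ∈ P}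

/-- The topology generated by the open sets of `ℍ` and the sets `U_P`. -/
instance : TopologicalSpace (E.Hat ι) :=
  TopologicalSpace.generateFrom
    ({U | ∃ O : Set ℍ, IsOpen O ∧ U = Sum.inl '' O} ∪
      {U | ∃ P ∈ halfPlanes π, U = E.halfPlaneNhd ι P})

/-- The change-of-basepoint isomorphism along the image in the surface of a path in `ℍ` between
the chosen lifts of the two basepoints. -/
def change (E₁ E₂ : CutSystem π) (c : Path E₁.z E₂.z) : E₁.group ≃* E₂.group :=
  changeBasepoint (c.map π.continuous)

/-- The map that is the identity on `ℍ` and `b` on the boundary. -/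
def glue {E₁ E₂ : CutSystem π} (ι₁ : Realization E₁.cayley → ℍ) (ι₂ : Realization E₂.cayley → ℍ)
    (b : GromovBoundary E₁.cayley → GromovBoundary E₂.cayley) : E₁.Hat ι₁ → E₂.Hat ι₂ :=
  Sum.map id b

end CutSystem

end Surface

end IdealBoundary

end

/-! The lifts of the arcs cut `ℍ` into tiles, which are the translates of one lift of the simply
connected complement, so the tiles are labelled by the deck group. A loop dual to an arc lifts to a
path crossing exactly one lifted arc, hence the Cayley graph is the dual graph of this tiling
(`cayley_adj_iff`). It is connected because `ℍ` is. Each lifted arc separates `ℍ` and is disjoint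
from all the others, so each edge is a bridge and the graph is a tree (`cayley_isTree`).

Both fundamental groups are copies of the same deck group, and in these terms the change of
basepoint is the identity (`change_deckClass`). It is therefore bi-Lipschitz for the two word
metrics, both generating sets being finite. In a tree a quasi-geodesic sequence stays close to a
geodesic ray (`exists_geodesic_of_quasiGeodesic`), which gives a bijection of the Gromov boundaries
(`exists_boundary_bijection`). As `f` is at bounded distance from the vertex map, this bijection is
its boundary map.

For the topology it suffices that rays at finite Hausdorff distance, one in each graph, eventually
lie in the same half-planes (`eventually_mem_of_fellow`). By equivariance, corresponding late points
of the two rays lie in one translate `φ • L` of a fixed compact connected set `L`. A geodesic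
running into punctures at both ends has only finitely many translates meeting `L`
(`IsIdealGeodesic.finite_setOf_smul_mem`). So `φ • L` eventually misses the boundary of the
half-plane, and being connected it lies on one side. The finiteness needs the deck group to act
properly discontinuously, which follows once its elements are isometries, by the Schwarz–Pick lemma.
-/

noncomputable section

namespace IdealBoundary

/-! ### Quasi-geodesics in trees -/

section Tree

variable {V : Type*} {G : SimpleGraph V}

/-- In the tree `G` rooted at `o`, the vertex `x` is `v` or a descendant of `v`. -/
def Below (G : SimpleGraph V) (o v x : V) : Prop := G.dist o x = G.dist o v + G.dist v x

lemma exists_adj_dist_of_ne (hG : G.Connected) {v x : V} (h : x ≠ v) :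
    ∃ y, G.Adj y x ∧ G.dist v x = G.dist v y + 1 := by
  obtain ⟨p, hp⟩ := hG.exists_walk_length_eq_dist x v
  cases p with
  | nil => exact absurd rfl h
  | @cons _ y _ hxy q =>
    refine ⟨y, hxy.symm, ?_⟩
    have h1 := G.dist_le q
    have h2 := hG.dist_triangle (u := x) (v := y) (w := v)
    have h3 := SimpleGraph.dist_eq_one_iff_adj.2 hxy
    rw [SimpleGraph.Walk.length_cons] at hp
    rw [G.dist_comm (u := v) (v := x), G.dist_comm (u := v) (v := y)]
    omega

lemma parent_unique (hG : G.IsTree) {o x y y' : V} (h : G.Adj y x) (h' : G.Adj y' x)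
    (hd : G.dist o x = G.dist o y + 1) (hd' : G.dist o x = G.dist o y' + 1) : y = y' := by
  obtain ⟨p, hp⟩ := hG.1.exists_walk_length_eq_dist o y
  obtain ⟨p', hp'⟩ := hG.1.exists_walk_length_eq_dist o y'
  have h1 : (p.concat h).IsPath := SimpleGraph.Walk.isPath_of_length_eq_dist _ (by simp; omega)
  have h2 : (p'.concat h').IsPath := SimpleGraph.Walk.isPath_of_length_eq_dist _ (by simp; omega)
  have := (hG.existsUnique_path o x).unique h1 h2
  have := congrArg SimpleGraph.Walk.penultimate this
  simpa using this

/-- A branch can only be left through its root: a neighbour of `x` is either a child or the unique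
parent, and the parent lies on the way from `v` to `x`. -/
lemma Below.adj (hG : G.IsTree) {o v x y : V} (hx : Below G o v x) (hne : x ≠ v)
    (hxy : G.Adj x y) : Below G o v y := by
  unfold Below at *
  have h3 := SimpleGraph.dist_eq_one_iff_adj.2 hxy
  have t1 := hG.1.dist_triangle (u := o) (v := v) (w := y)
  have t2 := hG.1.dist_triangle (u := v) (v := x) (w := y)
  rcases hG.dist_eq_dist_add_one_of_adj o hxy with h | h
  · obtain ⟨y', hy', hd⟩ := exists_adj_dist_of_ne hG.1 hne
    have h4 := SimpleGraph.dist_eq_one_iff_adj.2 hy'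
    have t3 := hG.1.dist_triangle (u := o) (v := v) (w := y')
    have t4 := hG.1.dist_triangle (u := o) (v := y') (w := x)
    obtain rfl : y = y' := parent_unique hG hxy.symm hy' h (by omega)
    omega
  · omega

lemma exists_below (hG : G.Connected) (o : V) {j : ℕ} {x : V} (hj : j ≤ G.dist o x) :
    ∃ v, G.dist o v = j ∧ Below G o v x := by
  induction h : G.dist o x - j generalizing x with
  | zero => exact ⟨x, by omega, by simp [Below]⟩
  | succ n ih =>
    have hne : x ≠ o := by rintro rfl; simp at h
    obtain ⟨y, hy, hd⟩ := exists_adj_dist_of_ne hG hne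
    obtain ⟨v, hv, hb⟩ := ih (x := y) (by omega) (by omega)
    refine ⟨v, hv, ?_⟩
    have h3 := SimpleGraph.dist_eq_one_iff_adj.2 hy
    have t1 := hG.dist_triangle (u := o) (v := v) (w := x)
    have t2 := hG.dist_triangle (u := v) (v := y) (w := x)
    unfold Below at *
    omega

lemma Below.trans (hG : G.Connected) {o u v x : V} (h : Below G o u v) (h' : Below G o v x) :
    Below G o u x := by
  have t1 := hG.dist_triangle (u := o) (v := u) (w := x)
  have t2 := hG.dist_triangle (u := u) (v := v) (w := x)
  unfold Below at *
  omega

lemma Below.eq (hG : G.IsTree) {o v v' x : V} (hv : Below G o v x) (hv' : Below G o v' x)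
    (hd : G.dist o v = G.dist o v') : v = v' := by
  induction h : G.dist v x generalizing x with
  | zero =>
    have h0 := hG.1.dist_eq_zero_iff.1 h
    unfold Below at *
    exact h0.trans (hG.1.dist_eq_zero_iff.1 (by omega : G.dist v' x = 0)).symm
  | succ n ih =>
    have hne : x ≠ v := by rintro rfl; simp at h
    have hne' : x ≠ v' := by rintro rfl; simp [Below] at *; omega
    obtain ⟨y, hy, hd'⟩ := exists_adj_dist_of_ne hG.1 hne
    exact ih (hv.adj hG hne hy.symm) (hv'.adj hG hne' hy.symm) (by omega)

/-- A path from inside the branch at `v` to the outside passes through `v`. -/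
lemma Below.dist_le (hG : G.IsTree) {o v x y : V} (hx : Below G o v x) (hy : ¬ Below G o v y) :
    G.dist v x ≤ G.dist x y := by
  induction h : G.dist x y generalizing x with
  | zero => exact absurd (hG.1.dist_eq_zero_iff.1 h ▸ hx) hy
  | succ n ih =>
    by_cases hne : x = v
    · subst hne; simp
    have hxy : x ≠ y := by rintro rfl; simp at h
    obtain ⟨z, hz, hd⟩ := exists_adj_dist_of_ne hG.1 hxy
    have := ih (hx.adj hG hne hz.symm) (by rw [G.dist_comm]; rw [G.dist_comm] at h; omega)
    have h3 := SimpleGraph.dist_eq_one_iff_adj.2 hz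
    have t1 := hG.1.dist_triangle (u := v) (v := z) (w := x)
    omega

/-- In a tree, a quasi-geodesic sequence is at finite Hausdorff distance from a geodesic one. -/
theorem exists_geodesic_of_quasiGeodesic (hG : G.IsTree) (q : ℕ → V) (J L : ℕ)
    (hJ : ∀ n, G.dist (q n) (q (n + 1)) ≤ J)
    (hL : ∀ m n, n ≤ m + L * G.dist (q m) (q n) + L) :
    ∃ v : ℕ → V, (∀ n, G.Adj (v n) (v (n + 1))) ∧
      (∀ m n, m ≤ n → G.dist (v m) (v n) = n - m) ∧
      ∃ C, (∀ n, ∃ m, G.dist (q n) (v m) ≤ C) ∧ ∀ m, ∃ n, G.dist (q n) (v m) ≤ C := by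
  set o := q 0 with ho
  have far : ∀ R, ∃ N, ∀ n ≥ N, R ≤ G.dist o (q n) := by
    intro R
    refine ⟨L * R + L, fun n hn => ?_⟩
    by_contra! hlt
    have h1 := hL 0 n
    have : L * (G.dist (q 0) (q n) + 1) ≤ L * R := Nat.mul_le_mul_left _ hlt
    rcases Nat.eq_zero_or_pos L with rfl | hpos
    · have := hL n (n + 1); simp at this
    · have h5 : L * (G.dist (q 0) (q n) + 1) = L * G.dist (q 0) (q n) + L := by ring
      have : n = L * R + L ∨ n ≤ L * R := by omega
      omega
  have ev : ∀ j, ∃ v, G.dist o v = j ∧ ∃ N, ∀ n ≥ N, Below G o v (q n) := by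
    intro j
    -- At depth beyond `j + J` the distance to the root of a branch of depth `j` exceeds `J`, so no
    -- jump of the sequence can leave that branch any more.
    obtain ⟨N, hN⟩ := far (j + J + 1)
    obtain ⟨v, hv, hb⟩ := exists_below hG.1 o (x := q N) (j := j) (by have := hN N le_rfl; omega)
    refine ⟨v, hv, N, fun n hn => ?_⟩
    induction n, hn using Nat.le_induction with
    | base => exact hb
    | succ n hn ih =>
      by_contra hcon
      have h1 := ih.dist_le hG hcon
      have h2 := hN n hn
      have h3 := hJ n
      unfold Below at ih
      omega
  choose v hv hev using ev
  have adj : ∀ n, G.Adj (v n) (v (n + 1)) := by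
    intro n
    have hne : v (n + 1) ≠ o := by intro h; have := hv (n + 1); simp [h] at this
    obtain ⟨y, hy, hd⟩ := exists_adj_dist_of_ne hG.1 hne
    have hy1 := SimpleGraph.dist_eq_one_iff_adj.2 hy
    have hb : Below G o y (v (n + 1)) := by unfold Below; omega
    obtain ⟨N, hN⟩ := hev (n + 1)
    obtain ⟨N', hN'⟩ := hev n
    have h1 := hb.trans hG.1 (hN (max N N') (le_max_left _ _))
    have h2 := hN' (max N N') (le_max_right _ _)
    rw [h2.eq hG h1 (by have := hv n; have := hv (n + 1); omega)]
    exact hy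
  -- Consider the last entrance into the branch at `v j`: the preceding point is outside, so the
  -- jump into the branch bounds the distance to `v j`. Fixing `k 0 = 0` starts the interpolation
  -- below at the first index.
  have near : ∀ j, ∃ k, G.dist (v j) (q k) ≤ J ∧ (j = 0 → k = 0) := by
    intro j
    rcases Nat.eq_zero_or_pos j with rfl | hj
    · refine ⟨0, ?_, fun _ => rfl⟩
      have := hv 0
      rw [hG.1.dist_eq_zero_iff] at this
      simp [← this, ho]
    · classical
      have hex : ∃ N, ∀ n ≥ N, Below G o (v j) (q n) := hev j
      have hspec := Nat.find_spec hex
      have hmin := @Nat.find_min _ _ hex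
      set N := Nat.find hex
      have hN0 : N ≠ 0 := by
        intro h0
        have := hspec 0 (by omega)
        have := hv j
        simp [Below, ← ho] at *
        omega
      have hnot : ¬ Below G o (v j) (q (N - 1)) := by
        intro hb
        refine hmin (m := N - 1) (by omega) fun n hn => ?_
        rcases hn.eq_or_lt with rfl | hlt
        · exact hb
        · exact hspec n (by omega)
      have h1 := (hspec N le_rfl).dist_le hG hnot
      have h2 := hJ (N - 1)
      rw [Nat.sub_add_cancel (by omega), G.dist_comm] at h2
      exact ⟨N, h1.trans h2, by omega⟩
  choose k hk hk0 using near
  have lip : ∀ m n, m ≤ n → G.dist (q m) (q n) ≤ J * (n - m) := by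
    intro m n hmn
    induction n, hmn using Nat.le_induction with
    | base => simp
    | succ n hn ih =>
      have h1 := hG.1.dist_triangle (u := q m) (v := q n) (w := q (n + 1))
      have h2 := hJ n
      rw [Nat.sub_add_comm hn, Nat.mul_add]
      omega
  have unb : ∀ m, ∃ j, m ≤ k j := by
    intro m
    by_contra! hlt
    have h1 := hlt (J * m + J + 1)
    have h2 := lip 0 (k (J * m + J + 1)) (Nat.zero_le _)
    rw [← ho] at h2
    have h3 := hk (J * m + J + 1)
    have h4 := hv (J * m + J + 1)
    have h5 := hG.1.dist_triangle (u := o) (v := q (k (J * m + J + 1))) (w := v (J * m + J + 1))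
    rw [G.dist_comm] at h3
    have h6 : J * (k (J * m + J + 1) - 0) ≤ J * m := Nat.mul_le_mul_left _ (by omega)
    omega
  -- For the least `j` with `m ≤ k j`, the index `m` lies between `k (j - 1)` and `k j`, although
  -- `k` need not be monotone. The values of `q` at these two indices are at distance at most `2 * J
  -- + 1`, so the indices differ by at most `L * (2 * J + 1) + L`, and each index step costs at most
  -- `J`.
  refine ⟨v, adj, ?_, J * (L * (2 * J + 1) + L) + J, ?_, ?_⟩
  · intro m n hmn
    have h1 := hG.1.dist_triangle (u := o) (v := v m) (w := v n)
    rw [hv, hv] at h1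
    refine le_antisymm ?_ (by omega)
    clear h1
    induction n, hmn using Nat.le_induction with
    | base => simp
    | succ n hn ih =>
      have h1 := hG.1.dist_triangle (u := v m) (v := v n) (w := v (n + 1))
      have h2 := SimpleGraph.dist_eq_one_iff_adj.2 (adj n)
      omega
  · intro m
    classical
    have hspec := Nat.find_spec (unb m)
    have hmin := @Nat.find_min _ _ (unb m)
    set j := Nat.find (unb m)
    refine ⟨j, ?_⟩
    have hkj := hk j
    rw [G.dist_comm] at hkj
    have h3 := hG.1.dist_triangle (u := q m) (v := q (k j)) (w := v j)
    rcases Nat.eq_zero_or_pos j with h0 | hpos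
    · have h1 := hk0 j h0
      obtain rfl : m = 0 := by omega
      rw [h1] at hkj
      exact hkj.trans (Nat.le_add_left _ _)
    · have h1 := hmin (m := j - 1) (by omega)
      have h2 := hL (k (j - 1)) (k j)
      have h4 := hG.1.dist_triangle (u := q (k (j - 1))) (v := v (j - 1)) (w := q (k j))
      have h5 := hG.1.dist_triangle (u := v (j - 1)) (v := v j) (w := q (k j))
      have h6 := hk (j - 1)
      have h7 := SimpleGraph.dist_eq_one_iff_adj.2 (adj (j - 1))
      have h9 := hk j
      rw [Nat.sub_add_cancel (by omega)] at h7
      rw [G.dist_comm] at h6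
      have h8 : G.dist (q (k (j - 1))) (q (k j)) ≤ 2 * J + 1 := by omega
      have h10 : L * G.dist (q (k (j - 1))) (q (k j)) ≤ L * (2 * J + 1) := Nat.mul_le_mul_left _ h8
      have h11 := lip m (k j) hspec
      have h12 : J * (k j - m) ≤ J * (L * (2 * J + 1) + L) := Nat.mul_le_mul_left _ (by omega)
      omega
  · intro j
    refine ⟨k j, ?_⟩
    rw [G.dist_comm]
    exact (hk j).trans (Nat.le_add_left _ _)

end Tree

/-! ### The path metric of a metric graph, and rays through vertices -/

section Realization

variable {V W : Type*} {G : SimpleGraph V} {H : SimpleGraph W}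

lemma edgeFun_left {u v : V} (h : u ≠ v) (t : ℝ) : edgeFun u v t u = 1 - t := by
  simp [edgeFun, h]

lemma edgeFun_right {u v : V} (h : u ≠ v) (t : ℝ) : edgeFun u v t v = t := by
  simp [edgeFun, h.symm]

lemma edgeFun_of_ne {u v w : V} (hu : w ≠ u) (hv : w ≠ v) (t : ℝ) : edgeFun u v t w = 0 := by
  simp [edgeFun, hu, hv]

open Classical in
lemma edgeFun_self (u : V) (t : ℝ) : edgeFun u u t = Pi.single u 1 := by
  funext w
  by_cases h : w = u
  · subst h; simp [edgeFun]
  · simp [edgeFun, h]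

open Classical in
lemma edgeFun_zero (u v : V) : edgeFun u v 0 = Pi.single u 1 := by
  simp [edgeFun]

open Classical in
lemma edgeFun_one (u v : V) : edgeFun u v 1 = Pi.single v 1 := by
  simp [edgeFun]

open Classical in
lemma vertex_val (u : V) : (vertex G u).1 = Pi.single u 1 := edgeFun_self u 0

lemma edgePoint_zero {u v : V} (h : G.Adj u v) : edgePoint h 0 = vertex G u :=
  Subtype.ext ((edgeFun_zero u v).trans (vertex_val u).symm)

lemma edgePoint_one {u v : V} (h : G.Adj u v) : edgePoint h 1 = vertex G v :=
  Subtype.ext ((edgeFun_one u v).trans (vertex_val v).symm)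

lemma Realization.eq_vertex_or_edgePoint (x : Realization G) :
    (∃ u, x = vertex G u) ∨ ∃ (u v : V) (h : G.Adj u v) (t : Icc (0 : ℝ) 1),
      x = edgePoint h t := by
  obtain ⟨x, u, v, huv, t, ht, rfl⟩ := x
  rcases huv with rfl | huv
  · exact Or.inl ⟨u, Subtype.ext ((edgeFun_self u t).trans (vertex_val u).symm)⟩
  · exact Or.inr ⟨u, v, huv, ⟨t, ht⟩, rfl⟩

lemma pos_vertex_iff {u w : V} : 0 < (vertex G u).1 w ↔ w = u := by
  classical
  rw [vertex_val]
  by_cases h : w = u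
  · subst h; simp
  · simp [h]

lemma pos_edgePoint {u v w : V} {h : G.Adj u v} {t : Icc (0 : ℝ) 1}
    (hw : 0 < (edgePoint h t).1 w) : w = u ∨ w = v := by
  by_contra! hne
  have : (edgePoint h t).1 w = 0 := edgeFun_of_ne hne.1 hne.2 _
  linarith

lemma Realization.coord_mem (x : Realization G) (w : V) : x.1 w ∈ Icc (0 : ℝ) 1 := by
  classical
  rcases x.eq_vertex_or_edgePoint with ⟨u, rfl⟩ | ⟨u, v, h, t, rfl⟩
  · rw [vertex_val]
    by_cases h : w = u
    · subst h; simp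
    · simp [h]
  · change edgeFun u v t w ∈ _
    have := t.2.1
    have := t.2.2
    by_cases hu : w = u
    · subst hu; rw [edgeFun_left h.ne]; constructor <;> linarith
    by_cases hv : w = v
    · subst hv; rw [edgeFun_right h.ne]; constructor <;> linarith
    · rw [edgeFun_of_ne hu hv]; simp

lemma Realization.exists_pos (x : Realization G) : ∃ v, 0 < x.1 v := by
  rcases x.eq_vertex_or_edgePoint with ⟨u, rfl⟩ | ⟨u, v, h, t, rfl⟩
  · exact ⟨u, pos_vertex_iff.2 rfl⟩
  · by_cases ht : 0 < (t : ℝ)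
    · exact ⟨v, by change 0 < edgeFun u v t v; rwa [edgeFun_right h.ne]⟩
    · exact ⟨u, by change 0 < edgeFun u v t u; rw [edgeFun_left h.ne]; linarith⟩

lemma Realization.dist_le_one (x : Realization G) {u w : V} (hu : 0 < x.1 u) (hw : 0 < x.1 w) :
    G.dist u w ≤ 1 := by
  rcases x.eq_vertex_or_edgePoint with ⟨a, rfl⟩ | ⟨a, b, h, t, rfl⟩
  · rw [pos_vertex_iff] at hu hw
    subst hu; subst hw; simp
  · rcases pos_edgePoint hu with rfl | rfl <;> rcases pos_edgePoint hw with rfl | rfl <;>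
      simp [SimpleGraph.dist_eq_one_iff_adj.2 h, SimpleGraph.dist_eq_one_iff_adj.2 h.symm]

/-- A vertex of the cell that contains `x`. -/
def near (x : Realization G) : V := x.exists_pos.choose

lemma near_pos (x : Realization G) : 0 < x.1 (near x) := x.exists_pos.choose_spec

@[simp] lemma near_vertex (u : V) : near (vertex G u) = u := pos_vertex_iff.1 (near_pos _)

lemma pathDist_comm (x y : Realization G) : pathDist x y = pathDist y x := by
  unfold pathDist
  congr 1
  ext L
  simp only [Set.mem_union, Set.mem_ofPred_eq]
  refine or_congr ?_ ?_
  · simp only [abs_sub_comm]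
    exact and_congr_left' ⟨fun ⟨u, v, h, h1, h2⟩ => ⟨u, v, h, h2, h1⟩,
      fun ⟨u, v, h, h1, h2⟩ => ⟨u, v, h, h2, h1⟩⟩
  · constructor <;> rintro ⟨u, w, hu, hw, rfl⟩ <;> refine ⟨w, u, hw, hu, ?_⟩ <;>
      rw [G.dist_comm] <;> ring

lemma pathDist_set_lower (x y : Realization G) {B : ℝ}
    (h1 : ∀ u v, G.Adj u v → Function.support x.1 ⊆ {u, v} → Function.support y.1 ⊆ {u, v} →
      B ≤ ⨆ v, |x.1 v - y.1 v|)
    (h2 : ∀ u w, 0 < x.1 u → 0 < y.1 w →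
      B ≤ (1 - x.1 u) + (G.dist u w : ℝ) + (1 - y.1 w)) : B ≤ pathDist x y := by
  refine le_csInf ⟨_, Or.inr ⟨near x, near y, near_pos x, near_pos y, rfl⟩⟩ ?_
  rintro L (⟨⟨u, v, h, hx, hy⟩, rfl⟩ | ⟨u, w, hu, hw, rfl⟩)
  · exact h1 u v h hx hy
  · exact h2 u w hu hw

lemma bddBelow_pathDist_set (x y : Realization G) :
    BddBelow ({L : ℝ | (∃ u v, G.Adj u v ∧ Function.support x.1 ⊆ {u, v} ∧
            Function.support y.1 ⊆ {u, v}) ∧ L = ⨆ v, |x.1 v - y.1 v|} ∪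
        {L : ℝ | ∃ u w, 0 < x.1 u ∧ 0 < y.1 w ∧
            L = (1 - x.1 u) + (G.dist u w : ℝ) + (1 - y.1 w)}) := by
  refine ⟨0, ?_⟩
  rintro L (⟨-, rfl⟩ | ⟨u, w, hu, hw, rfl⟩)
  · exact Real.iSup_nonneg fun _ => abs_nonneg _
  · have := (x.coord_mem u).2
    have := (y.coord_mem w).2
    have := Nat.cast_nonneg (α := ℝ) (G.dist u w)
    linarith

lemma pathDist_le_of_pos {x y : Realization G} {u w : V} (hu : 0 < x.1 u) (hw : 0 < y.1 w) :
    pathDist x y ≤ (1 - x.1 u) + (G.dist u w : ℝ) + (1 - y.1 w) :=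
  csInf_le (bddBelow_pathDist_set x y) (Or.inr ⟨u, w, hu, hw, rfl⟩)

lemma pathDist_le_iSup {x y : Realization G} {u v : V} (h : G.Adj u v)
    (hx : Function.support x.1 ⊆ {u, v}) (hy : Function.support y.1 ⊆ {u, v}) :
    pathDist x y ≤ ⨆ v, |x.1 v - y.1 v| :=
  csInf_le (bddBelow_pathDist_set x y) (Or.inl ⟨⟨u, v, h, hx, hy⟩, rfl⟩)

/-- Together with `dist_near_le` this identifies the path metric with the graph distance of nearby
vertices up to an error of 2. Coarse statements are transferred to vertices this way, without a
triangle inequality for `pathDist`. -/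
lemma pathDist_le_dist (x y : Realization G) :
    pathDist x y ≤ G.dist (near x) (near y) + 2 := by
  have := pathDist_le_of_pos (near_pos x) (near_pos y)
  have := near_pos x
  have := near_pos y
  linarith

lemma dist_le_pathDist (hG : G.Connected) (x y : Realization G) {a b : V} (ha : 0 < x.1 a)
    (hb : 0 < y.1 b) : (G.dist a b : ℝ) ≤ pathDist x y + 2 := by
  rw [← sub_le_iff_le_add]
  refine pathDist_set_lower x y ?_ ?_
  · intro u v h hx hy
    have h0 : (0 : ℝ) ≤ ⨆ v, |x.1 v - y.1 v| := Real.iSup_nonneg fun _ => abs_nonneg _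
    have ha' := hx (Function.mem_support.2 ha.ne')
    have hb' := hy (Function.mem_support.2 hb.ne')
    have : G.dist a b ≤ 1 := by
      rcases ha' with rfl | rfl <;> rcases hb' with rfl | rfl <;>
        simp [SimpleGraph.dist_eq_one_iff_adj.2 h, SimpleGraph.dist_eq_one_iff_adj.2 h.symm]
    have : (G.dist a b : ℝ) ≤ 1 := by exact_mod_cast this
    linarith
  · intro u w hu hw
    have h1 := x.dist_le_one ha hu
    have h2 := y.dist_le_one hw hb
    have h3 := hG.dist_triangle (u := a) (v := u) (w := b)
    have h4 := hG.dist_triangle (u := u) (v := w) (w := b)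
    have h5 : G.dist a b ≤ G.dist u w + 2 := by omega
    have : (G.dist a b : ℝ) ≤ G.dist u w + 2 := by exact_mod_cast h5
    have := (x.coord_mem u).2
    have := (y.coord_mem w).2
    linarith

lemma dist_near_le (hG : G.Connected) (x y : Realization G) :
    (G.dist (near x) (near y) : ℝ) ≤ pathDist x y + 2 :=
  dist_le_pathDist hG x y (near_pos x) (near_pos y)

section VertexRay

variable (v : ℕ → V) (adj : ∀ n, G.Adj (v n) (v (n + 1)))

/-- The point at distance `t` from the origin on the path through the vertices `v n`. -/
def vertexRayFun (t : ℝ≥0) : Realization G :=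
  edgePoint (adj ⌊t⌋₊) ⟨(t : ℝ) - ⌊t⌋₊, by
    have := Nat.floor_le (zero_le (a := t))
    have h' : ((⌊t⌋₊ : ℝ≥0) : ℝ) ≤ t := this
    simpa using h', by
    have := (Nat.lt_floor_add_one t).le
    have h' : (t : ℝ) ≤ ((⌊t⌋₊ + 1 : ℝ≥0) : ℝ) := this
    push_cast at h'
    linarith⟩

lemma vertexRayFun_left (t : ℝ≥0) :
    (vertexRayFun v adj t).1 (v ⌊t⌋₊) = 1 - ((t : ℝ) - ⌊t⌋₊) :=
  edgeFun_left (adj _).ne _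

lemma vertexRayFun_right (t : ℝ≥0) :
    (vertexRayFun v adj t).1 (v (⌊t⌋₊ + 1)) = (t : ℝ) - ⌊t⌋₊ :=
  edgeFun_right (adj _).ne _

lemma vertexRayFun_eq_zero {t : ℝ≥0} {w : V} (h : w ≠ v ⌊t⌋₊) (h' : w ≠ v (⌊t⌋₊ + 1)) :
    (vertexRayFun v adj t).1 w = 0 :=
  edgeFun_of_ne h h' _

lemma floor_bounds (t : ℝ≥0) : (⌊t⌋₊ : ℝ) ≤ t ∧ (t : ℝ) < ⌊t⌋₊ + 1 := by
  constructor
  · exact_mod_cast Nat.floor_le (zero_le (a := t))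
  · exact_mod_cast Nat.lt_floor_add_one t

/-- A ray must realize distances exactly, so both kinds of competitors in the infimum are examined.
A detour through vertices reduces to the triangle inequality in `ℝ`, because `1 - x.1 (v i)` is the
distance from `s` to `i`. -/
lemma pathDist_vertexRayFun_of_le (hv : ∀ m n, m ≤ n → G.dist (v m) (v n) = n - m)
    {s t : ℝ≥0} (hst : s ≤ t) :
    pathDist (vertexRayFun v adj s) (vertexRayFun v adj t) = t - s := by
  have hst' : (s : ℝ) ≤ t := hst
  obtain ⟨hs1, hs2⟩ := floor_bounds s
  obtain ⟨ht1, ht2⟩ := floor_bounds t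
  have hmn : ⌊s⌋₊ ≤ ⌊t⌋₊ := Nat.floor_le_floor hst
  have inj : Function.Injective v := by
    intro i j hij
    rcases le_total i j with h | h
    · have := hv i j h; simp [hij] at this; omega
    · have := hv j i h; simp [hij] at this; omega
  have hd : ∀ i j, (G.dist (v i) (v j) : ℝ) = |(j : ℝ) - i| := by
    intro i j
    rcases le_total i j with h | h
    · rw [hv i j h, Nat.cast_sub h, abs_of_nonneg]
      simpa using h
    · rw [G.dist_comm, hv j i h, Nat.cast_sub h, abs_sub_comm, abs_of_nonneg]
      simpa using h
  have sl := vertexRayFun_left v adj s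
  have sr := vertexRayFun_right v adj s
  have tl := vertexRayFun_left v adj t
  have tr := vertexRayFun_right v adj t
  set x := vertexRayFun v adj s with hx
  set y := vertexRayFun v adj t with hy
  set m := ⌊s⌋₊
  set n := ⌊t⌋₊
  have bdd : BddAbove (range fun w => |x.1 w - y.1 w|) := by
    refine ⟨1, ?_⟩
    rintro _ ⟨w, rfl⟩
    have h1 := x.coord_mem w
    have h2 := y.coord_mem w
    exact abs_le.2 ⟨by linarith [h1.1, h2.2], by linarith [h1.2, h2.1]⟩
  have coordx : ∀ w, 0 < x.1 w → ∃ i : ℕ, w = v i ∧ 1 - x.1 w = |(s : ℝ) - i| := by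
    intro w hw
    rcases pos_edgePoint hw with rfl | rfl
    · exact ⟨m, rfl, by rw [sl, abs_of_nonneg (by linarith)]; ring⟩
    · refine ⟨m + 1, rfl, ?_⟩
      rw [sr, abs_sub_comm, abs_of_nonneg] <;> push_cast <;> linarith
  have coordy : ∀ w, 0 < y.1 w → ∃ i : ℕ, w = v i ∧ 1 - y.1 w = |(t : ℝ) - i| := by
    intro w hw
    rcases pos_edgePoint hw with rfl | rfl
    · exact ⟨n, rfl, by rw [tl, abs_of_nonneg (by linarith)]; ring⟩
    · refine ⟨n + 1, rfl, ?_⟩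
      rw [tr, abs_sub_comm, abs_of_nonneg] <;> push_cast <;> linarith
  refine le_antisymm ?_ (pathDist_set_lower x y ?_ ?_)
  · rcases hmn.eq_or_lt with h | h
    · rw [← h] at tl tr ht1 ht2
      have supp : ∀ (z : ℝ≥0), ⌊z⌋₊ = m →
          Function.support (vertexRayFun v adj z).1 ⊆ {v m, v (m + 1)} := by
        intro z hz w hw
        by_contra! hne
        simp only [Set.mem_insert_iff, Set.mem_singleton_iff, not_or] at hne
        exact hw (vertexRayFun_eq_zero v adj (by rw [hz]; exact hne.1) (by rw [hz]; exact hne.2))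
      refine (pathDist_le_iSup (adj m) (supp s rfl) (supp t h.symm)).trans ?_
      refine Real.iSup_le (fun w => ?_) (by linarith)
      change |x.1 w - y.1 w| ≤ _
      by_cases h1 : w = v m
      · rw [h1, sl, tl, abs_le]; constructor <;> linarith
      by_cases h2 : w = v (m + 1)
      · rw [h2, sr, tr, abs_le]; constructor <;> linarith
      · rw [hx, hy, vertexRayFun_eq_zero v adj h1 h2,
          vertexRayFun_eq_zero v adj (t := t) (by rw [← show m = ⌊t⌋₊ from h]; exact h1)
            (by rw [← show m = ⌊t⌋₊ from h]; exact h2)]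
        simp only [sub_self, abs_zero]; linarith
    · have hyn : 0 < y.1 (v n) := by rw [tl]; linarith
      -- Only vertices with positive coordinate may serve as exits, so when `s` is the integer `m`
      -- the path has to start at `v m` itself.
      by_cases ha : 0 < (s : ℝ) - m
      · refine (pathDist_le_of_pos (x := x) (u := v (m + 1)) (by rw [sr]; exact ha) hyn).trans ?_
        rw [sr, tl, hd, abs_of_nonneg]
        · push_cast; linarith
        · have : ((m + 1 : ℕ) : ℝ) ≤ n := by exact_mod_cast h
          linarith
      · refine (pathDist_le_of_pos (x := x) (u := v m) (by rw [sl]; linarith) hyn).trans ?_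
        rw [sl, tl, hd, abs_of_nonneg]
        · linarith
        · have : (m : ℝ) ≤ n := by exact_mod_cast hmn
          linarith
  -- If the integer parts differ but both points lie on one edge, that edge joins `v m` to `v (m +
  -- 1)` and the later point is the vertex `v (m + 1)`.
  · intro p q hpq hxs hys
    rcases hmn.eq_or_lt with h | h
    · refine le_trans ?_ (le_ciSup bdd (v m))
      rw [← h] at tl
      simp only [sl, tl]
      exact le_trans (by linarith) (le_abs_self _)
    · have hxm : v m ∈ ({p, q} : Set V) :=
        hxs (Function.mem_support.2 (by rw [sl]; linarith))
      have hyn : v n ∈ ({p, q} : Set V) :=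
        hys (Function.mem_support.2 (by rw [tl]; linarith))
      have hne : v m ≠ v n := fun h' => h.ne (inj h')
      have hpq' : ({p, q} : Set V) = {v m, v n} := by
        rcases hxm with h1 | h1 <;> rcases hyn with h2 | h2
        · exact absurd (h1.trans h2.symm) hne
        · rw [h1, h2]
        · rw [h1, h2, Set.pair_comm]
        · exact absurd (h1.trans h2.symm) hne
      have hadj : G.dist (v m) (v n) ≤ 1 := by
        rcases hxm with h1 | h1 <;> rcases hyn with h2 | h2 <;> rw [h1, h2] <;>
          simp [SimpleGraph.dist_eq_one_iff_adj.2 hpq, SimpleGraph.dist_eq_one_iff_adj.2 hpq.symm]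
      rw [hv m n hmn] at hadj
      have hn : n = m + 1 := by omega
      have hb : (t : ℝ) - n = 0 := by
        by_contra hb
        have : v (n + 1) ∈ ({p, q} : Set V) := hys (Function.mem_support.2 (by rw [tr]; exact hb))
        rw [hpq'] at this
        rcases this with h1 | h1 <;> have := inj h1 <;> omega
      have hym : y.1 (v m) = 0 := by
        by_contra h0
        have h0 : 0 < y.1 (v m) := lt_of_le_of_ne (y.coord_mem _).1 (Ne.symm h0)
        rcases pos_edgePoint h0 with h1 | h1
        · exact hne h1
        · have := inj h1; omega
      refine le_trans ?_ (le_ciSup bdd (v m))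
      simp only [sl, hym]
      refine le_trans ?_ (le_abs_self _)
      have : (n : ℝ) = m + 1 := by exact_mod_cast hn
      linarith
  · intro u w hu hw
    obtain ⟨i, rfl, hi⟩ := coordx u hu
    obtain ⟨j, rfl, hj⟩ := coordy w hw
    rw [hi, hj, hd]
    have h1 := abs_sub_le (t : ℝ) j i
    have h2 := abs_sub_le (t : ℝ) i s
    have h3 := le_abs_self ((t : ℝ) - s)
    rw [abs_sub_comm (s : ℝ)]
    linarith [abs_sub_comm (i : ℝ) s]

/-- The geodesic ray through a geodesic sequence of vertices. -/
def vertexRay (hv : ∀ m n, m ≤ n → G.dist (v m) (v n) = n - m) : GeodesicRay G where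
  toFun := vertexRayFun v adj
  pathDist_eq s t := by
    rcases le_total s t with h | h
    · rw [pathDist_vertexRayFun_of_le v adj hv h, abs_sub_comm, abs_of_nonneg]
      exact sub_nonneg.2 h
    · rw [pathDist_comm, pathDist_vertexRayFun_of_le v adj hv h, abs_of_nonneg]
      exact sub_nonneg.2 h

end VertexRay

end Realization

/-! ### Gromov boundaries and maps between them -/

section Boundary

variable {V W : Type*} {G : SimpleGraph V} {H : SimpleGraph W}

lemma GeodesicRay.abs_le_dist (r : GeodesicRay G) (s t : ℝ≥0) :
    |(s : ℝ) - t| ≤ G.dist (near (r.toFun s)) (near (r.toFun t)) + 2 := by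
  rw [← r.pathDist_eq]
  exact pathDist_le_dist _ _

lemma GeodesicRay.dist_le_abs (hG : G.Connected) (r : GeodesicRay G) (s t : ℝ≥0) :
    (G.dist (near (r.toFun s)) (near (r.toFun t)) : ℝ) ≤ |(s : ℝ) - t| + 2 := by
  rw [← r.pathDist_eq]
  exact dist_near_le hG _ _

lemma exists_nat_le_of_pathDist {α : Type*} (hG : G.Connected) (x y : α → Realization G) :
    (∃ C : ℝ, ∀ a, pathDist (x a) (y a) ≤ C) ↔
      ∃ C : ℕ, ∀ a, G.dist (near (x a)) (near (y a)) ≤ C := by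
  constructor
  · rintro ⟨C, hC⟩
    refine ⟨⌈C + 2⌉₊, fun a => ?_⟩
    have : (G.dist (near (x a)) (near (y a)) : ℝ) ≤ C + 2 :=
      (dist_near_le hG _ _).trans (by linarith [hC a])
    exact_mod_cast this.trans (Nat.le_ceil _)
  · rintro ⟨C, hC⟩
    refine ⟨C + 2, fun a => (pathDist_le_dist _ _).trans ?_⟩
    have : (G.dist (near (x a)) (near (y a)) : ℝ) ≤ C := by exact_mod_cast hC a
    linarith

lemma asymptotic_iff (hG : G.Connected) (r r' : GeodesicRay G) :
    Asymptotic r r' ↔ ∃ C : ℕ, ∀ t, G.dist (near (r.toFun t)) (near (r'.toFun t)) ≤ C :=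
  exists_nat_le_of_pathDist hG r.toFun r'.toFun

lemma asymptotic_equivalence (hG : G.Connected) : Equivalence (Asymptotic (G := G)) where
  refl r := (asymptotic_iff hG r r).2 ⟨0, by simp⟩
  symm {r r'} h := by
    rw [asymptotic_iff hG] at *
    simpa only [G.dist_comm] using h
  trans {r r' r''} h h' := by
    rw [asymptotic_iff hG] at *
    obtain ⟨C, hC⟩ := h
    obtain ⟨C', hC'⟩ := h'
    exact ⟨C + C', fun t => hG.dist_triangle.trans (add_le_add (hC t) (hC' t))⟩

lemma class_eq_iff (hG : G.Connected) (r r' : GeodesicRay G) :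
    r.class = r'.class ↔ Asymptotic r r' :=
  (asymptotic_equivalence hG).quot_mk_eq_iff r r'

/-- The image of the ray `r` under the vertex map `β` and the ray `r'` are at finite Hausdorff
distance. -/
def Fellow (β : V → W) (r : GeodesicRay G) (r' : GeodesicRay H) : Prop :=
  ∃ C : ℕ, (∀ t, ∃ s, H.dist (β (near (r.toFun t))) (near (r'.toFun s)) ≤ C) ∧
    ∀ s, ∃ t, H.dist (β (near (r.toFun t))) (near (r'.toFun s)) ≤ C

/-- Finite Hausdorff distance pairs the time `s` on `r'` with some time `u` on `r''`. Both times are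
distances from the origins up to a bounded error, so `u` and `s` differ boundedly and `u` may be
replaced by `s`. -/
lemma Fellow.asymptotic (hH : H.Connected) {β : V → W} {r : GeodesicRay G}
    {r' r'' : GeodesicRay H} (h : Fellow β r r') (h' : Fellow β r r'') : Asymptotic r' r'' := by
  rw [asymptotic_iff hH]
  obtain ⟨C, hC, hC2⟩ := h
  obtain ⟨C', hC', -⟩ := h'
  have key : ∀ s, ∃ u, H.dist (near (r'.toFun s)) (near (r''.toFun u)) ≤ C + C' := by
    intro s
    obtain ⟨t, ht⟩ := hC2 s
    obtain ⟨u, hu⟩ := hC' t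
    rw [H.dist_comm] at ht
    exact ⟨u, hH.dist_triangle.trans (add_le_add ht hu)⟩
  set D := H.dist (near (r'.toFun 0)) (near (r''.toFun 0)) with hD
  refine ⟨2 * (C + C') + D + 6, fun s => ?_⟩
  obtain ⟨u, hu⟩ := key s
  have h1 := r'.abs_le_dist 0 s
  have h2 := r'.dist_le_abs hH 0 s
  have h3 := r''.abs_le_dist 0 u
  have h4 := r''.dist_le_abs hH 0 u
  have h5 := r''.dist_le_abs hH u s
  simp only [NNReal.coe_zero, zero_sub, abs_neg, NNReal.abs_eq] at h1 h2 h3 h4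
  have e1 := hH.dist_triangle (u := near (r'.toFun 0)) (v := near (r''.toFun u))
    (w := near (r'.toFun s))
  have e2 := hH.dist_triangle (u := near (r'.toFun 0)) (v := near (r''.toFun 0))
    (w := near (r''.toFun u))
  have e3 := hH.dist_triangle (u := near (r''.toFun 0)) (v := near (r'.toFun 0))
    (w := near (r''.toFun u))
  have e4 := hH.dist_triangle (u := near (r'.toFun 0)) (v := near (r'.toFun s))
    (w := near (r''.toFun u))
  have e5 := hH.dist_triangle (u := near (r'.toFun s)) (v := near (r''.toFun u))
    (w := near (r''.toFun s))
  rw [H.dist_comm (u := near (r''.toFun u)) (v := near (r'.toFun s))] at e1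
  rw [H.dist_comm (u := near (r''.toFun 0)) (v := near (r'.toFun 0))] at e3
  rw [← hD] at e2 e3
  have f1 : (H.dist (near (r'.toFun 0)) (near (r'.toFun s)) : ℝ) ≤
      D + H.dist (near (r''.toFun 0)) (near (r''.toFun u)) + (C + C') := by
    exact_mod_cast e1.trans (add_le_add e2 hu)
  have f2 : (H.dist (near (r''.toFun 0)) (near (r''.toFun u)) : ℝ) ≤
      D + (H.dist (near (r'.toFun 0)) (near (r'.toFun s)) + (C + C')) := by
    exact_mod_cast e3.trans (add_le_add_right (e4.trans (add_le_add_right hu _)) _)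
  have f3 : |(u : ℝ) - s| ≤ D + (C + C') + 4 := by
    rw [abs_le]; constructor <;> linarith
  have f4 : (H.dist (near (r''.toFun u)) (near (r''.toFun s)) : ℝ) ≤
      ((D + (C + C') + 6 : ℕ) : ℝ) := by
    push_cast; linarith
  have f5 : H.dist (near (r''.toFun u)) (near (r''.toFun s)) ≤ D + (C + C') + 6 := by
    exact_mod_cast f4
  omega

lemma Fellow.congr_right (hH : H.Connected) {β : V → W} {r : GeodesicRay G}
    {r' r'' : GeodesicRay H} (h : Fellow β r r') (h' : Asymptotic r' r'') : Fellow β r r'' := by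
  rw [asymptotic_iff hH] at h'
  obtain ⟨C, hC, hC2⟩ := h
  obtain ⟨C', hC'⟩ := h'
  refine ⟨C + C', fun t => ?_, fun s => ?_⟩
  · obtain ⟨s, hs⟩ := hC t
    exact ⟨s, hH.dist_triangle.trans (add_le_add hs (hC' s))⟩
  · obtain ⟨t, ht⟩ := hC2 s
    exact ⟨t, hH.dist_triangle.trans (add_le_add ht (hC' s))⟩

lemma Fellow.congr_left (hG : G.Connected) (hH : H.Connected) {β : V → W} {K : ℕ}
    (hβ : ∀ u v, H.dist (β u) (β v) ≤ K * G.dist u v) {r s : GeodesicRay G}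
    {r' : GeodesicRay H} (h : Fellow β r r') (h' : Asymptotic r s) : Fellow β s r' := by
  rw [asymptotic_iff hG] at h'
  obtain ⟨C, hC, hC2⟩ := h
  obtain ⟨C', hC'⟩ := h'
  have key : ∀ t, H.dist (β (near (s.toFun t))) (β (near (r.toFun t))) ≤ K * C' := by
    intro t
    rw [H.dist_comm]
    exact (hβ _ _).trans (Nat.mul_le_mul_left _ (hC' t))
  refine ⟨K * C' + C, fun t => ?_, fun s => ?_⟩
  · obtain ⟨s, hs⟩ := hC t
    exact ⟨s, hH.dist_triangle.trans (add_le_add (key t) hs)⟩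
  · obtain ⟨t, ht⟩ := hC2 s
    exact ⟨t, hH.dist_triangle.trans (add_le_add (key t) ht)⟩

lemma Fellow.symm {β : V ≃ W} {K : ℕ}
    (hβ : ∀ u v, G.dist u v ≤ K * H.dist (β u) (β v)) {r : GeodesicRay G}
    {r' : GeodesicRay H} (h : Fellow β r r') : Fellow β.symm r' r := by
  obtain ⟨C, hC, hC2⟩ := h
  have key : ∀ x y, H.dist (β x) y ≤ C → G.dist (β.symm y) x ≤ K * C := by
    intro x y hxy
    refine (hβ _ _).trans (Nat.mul_le_mul_left _ ?_)
    rwa [β.apply_symm_apply, H.dist_comm]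
  refine ⟨K * C, fun s => ?_, fun t => ?_⟩
  · obtain ⟨t, ht⟩ := hC2 s
    exact ⟨t, key _ _ ht⟩
  · obtain ⟨s, hs⟩ := hC t
    exact ⟨s, key _ _ hs⟩

/-- The ray is sampled at integer times. Consecutive nearby vertices are at distance at most `1 +
2`, whence the jump bound `K * 3`; the factor `K` and the additive error 2 are absorbed in `K + 2`.
-/
lemma exists_fellow (hG : G.Connected) (hH : H.IsTree) {β : V → W} {K : ℕ}
    (hβ : ∀ u v, H.dist (β u) (β v) ≤ K * G.dist u v)
    (hβ' : ∀ u v, G.dist u v ≤ K * H.dist (β u) (β v)) (r : GeodesicRay G) :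
    ∃ r' : GeodesicRay H, Fellow β r r' := by
  obtain ⟨v, adj, hv, C, hC, hC2⟩ := exists_geodesic_of_quasiGeodesic hH
    (fun n : ℕ => β (near (r.toFun n))) (K * 3) (K + 2) (fun n => by
      refine (hβ _ _).trans (Nat.mul_le_mul_left _ ?_)
      have := r.dist_le_abs hG n (n + 1 : ℕ)
      push_cast at this
      rw [abs_sub_comm, add_sub_cancel_left, abs_one] at this
      have : (G.dist (near (r.toFun n)) (near (r.toFun (n + 1 : ℕ))) : ℝ) ≤ (3 : ℕ) := by
        push_cast; linarith
      exact_mod_cast this) (fun m n => by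
      have h1 := r.abs_le_dist m n
      have h2 := hβ' (near (r.toFun m)) (near (r.toFun n))
      have h3 : (n : ℝ) ≤ m + G.dist (near (r.toFun m)) (near (r.toFun n)) + (2 : ℕ) := by
        have := (abs_le.1 h1).1
        push_cast at this ⊢
        linarith
      have h4 : n ≤ m + G.dist (near (r.toFun m)) (near (r.toFun n)) + 2 := by exact_mod_cast h3
      simp only [Nat.add_mul]
      omega)
  have hfl : ∀ t : ℝ≥0, |(t : ℝ) - ((⌊t⌋₊ : ℝ≥0) : ℝ)| ≤ 1 := by
    intro t
    obtain ⟨h1, h2⟩ := floor_bounds t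
    push_cast
    rw [abs_le]; constructor <;> linarith
  have hr : ∀ t, H.dist (β (near (r.toFun t))) (β (near (r.toFun ⌊t⌋₊))) ≤ K * 3 := by
    intro t
    refine (hβ _ _).trans (Nat.mul_le_mul_left _ ?_)
    have h1 := r.dist_le_abs hG t ⌊t⌋₊
    have h2 := hfl t
    have : (G.dist (near (r.toFun t)) (near (r.toFun ⌊t⌋₊)) : ℝ) ≤ (3 : ℕ) := by
      push_cast at *; linarith
    exact_mod_cast this
  have hr' : ∀ s, H.dist (v ⌊s⌋₊) (near ((vertexRay v adj hv).toFun s)) ≤ 1 := by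
    intro s
    refine Realization.dist_le_one ((vertexRay v adj hv).toFun s) ?_ (near_pos _)
    change 0 < (vertexRayFun v adj s).1 _
    rw [vertexRayFun_left]
    linarith [(floor_bounds s).2]
  refine ⟨vertexRay v adj hv, K * 3 + C + 1, fun t => ?_, fun s => ?_⟩
  · obtain ⟨m, hm⟩ := hC ⌊t⌋₊
    refine ⟨m, ?_⟩
    have h1 := hr' m
    rw [Nat.floor_natCast] at h1
    exact hH.1.dist_triangle.trans (add_le_add (hH.1.dist_triangle.trans
      (add_le_add (hr t) hm)) h1)
  · obtain ⟨n, hn⟩ := hC2 ⌊s⌋₊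
    refine ⟨n, (hH.1.dist_triangle.trans (add_le_add hn (hr' s))).trans ?_⟩
    omega

/-- A bi-Lipschitz bijection between the vertex sets of two trees induces a bijection between the
Gromov boundaries. -/
theorem exists_boundary_bijection (hG : G.IsTree) (hH : H.IsTree) (β : V ≃ W) {K : ℕ}
    (hβ : ∀ u v, H.dist (β u) (β v) ≤ K * G.dist u v)
    (hβ' : ∀ u v, G.dist u v ≤ K * H.dist (β u) (β v)) :
    ∃ b : GromovBoundary G → GromovBoundary H, Function.Bijective b ∧
      ∀ r r', b r.class = r'.class ↔ Fellow β r r' := by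
  choose F hF using exists_fellow hG.1 hH hβ hβ'
  have hβs : ∀ u v, H.dist u v ≤ K * G.dist (β.symm u) (β.symm v) := fun u v => by
    simpa using hβ (β.symm u) (β.symm v)
  have hβs' : ∀ u v, G.dist (β.symm u) (β.symm v) ≤ K * H.dist u v := fun u v => by
    simpa using hβ' (β.symm u) (β.symm v)
  have spec : ∀ r r', (F r).class = r'.class ↔ Fellow β r r' := by
    intro r r'
    rw [class_eq_iff hH.1]
    exact ⟨fun h => (hF r).congr_right hH.1 h, fun h => (hF r).asymptotic hH.1 h⟩
  have lift : ∀ r s : GeodesicRay G, Asymptotic r s → (F r).class = (F s).class := fun r s h =>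
    ((spec s (F r)).2 ((hF r).congr_left hG.1 hH.1 hβ h)).symm
  refine ⟨Quot.lift (fun r => (F r).class) lift, ⟨?_, ?_⟩, spec⟩
  -- The ray `F s` accompanies both `r` and `s`; applying the inverse vertex map to it makes `r` and
  -- `s` asymptotic.
  · rintro ⟨r⟩ ⟨s⟩ h
    have h1 : Fellow β r (F s) := (spec r (F s)).1 h
    exact (class_eq_iff hG.1 r s).2 ((h1.symm hβ').asymptotic hG.1 ((hF s).symm hβ'))
  · rintro ⟨r'⟩
    obtain ⟨r, hr⟩ := exists_fellow hH.1 hG hβs' hβs r'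
    exact ⟨r.class, (spec r r').2 (hr.symm (β := β.symm) hβs)⟩

/-- An edge goes to a geodesic segment of length at most `K`, so `f x` stays within a bounded
distance of the image of a vertex near `x`. Thus `f` matters only through `β`. -/
lemma IsGeodesicExtension.hausdorff_iff (hH : H.Connected) {β : V → W} {K : ℕ}
    (hβ : ∀ u v, G.Adj u v → H.dist (β u) (β v) ≤ K)
    {f : Realization G → Realization H} (hf : IsGeodesicExtension β f)
    (r : GeodesicRay G) (r' : GeodesicRay H) :
    (∃ C : ℝ, (∀ t, ∃ s, pathDist (f (r.toFun t)) (r'.toFun s) ≤ C) ∧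
      ∀ s, ∃ t, pathDist (f (r.toFun t)) (r'.toFun s) ≤ C) ↔ Fellow β r r' := by
  have close : ∀ x, H.dist (near (f x)) (β (near x)) ≤ K + 2 := by
    intro x
    rcases x.eq_vertex_or_edgePoint with ⟨u, rfl⟩ | ⟨u, v, h, t, rfl⟩
    · rw [hf.1, near_vertex, near_vertex, H.dist_self]; exact Nat.zero_le _
    · have hle : ∀ (s : Icc (0 : ℝ) 1) (w : W), f (edgePoint h s) = vertex H w →
          H.dist (near (f (edgePoint h t))) w ≤ K + 2 := by
        intro s w hw
        have h1 := hf.2 u v h t s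
        have h2 := dist_near_le hH (f (edgePoint h t)) (f (edgePoint h s))
        rw [hw, near_vertex] at h2
        have h3 : |(t : ℝ) - s| ≤ 1 := by
          have := t.2.1; have := t.2.2; have := s.2.1; have := s.2.2
          rw [abs_le]; constructor <;> linarith
        have h4 : (H.dist (β u) (β v) : ℝ) ≤ K := by exact_mod_cast hβ u v h
        have h5 : (H.dist (near (f (edgePoint h t))) w : ℝ) ≤ K + 2 := by
          rw [hw] at h1
          have := mul_le_mul h3 h4 (Nat.cast_nonneg _) zero_le_one
          linarith
        exact_mod_cast h5
      rcases pos_edgePoint (near_pos (edgePoint h t)) with h' | h' <;> rw [h']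
      · exact hle 0 _ (by rw [edgePoint_zero, hf.1])
      · exact hle 1 _ (by rw [edgePoint_one, hf.1])
  constructor
  · rintro ⟨C, hC, hC2⟩
    have key : ∀ x y, pathDist (f x) y ≤ C → H.dist (β (near x)) (near y) ≤ K + 2 + ⌈C + 2⌉₊ := by
      intro x y h
      have h1 := close x
      rw [H.dist_comm] at h1
      have h2 : (H.dist (near (f x)) (near y) : ℝ) ≤ C + 2 := by linarith [dist_near_le hH (f x) y]
      have h3 : H.dist (near (f x)) (near y) ≤ ⌈C + 2⌉₊ := by exact_mod_cast h2.trans (Nat.le_ceil _)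
      exact hH.dist_triangle.trans (add_le_add h1 h3)
    exact ⟨_, fun t => (hC t).imp fun s h => key _ _ h, fun s => (hC2 s).imp fun t h => key _ _ h⟩
  · rintro ⟨C, hC, hC2⟩
    have key : ∀ x y, H.dist (β (near x)) (near y) ≤ C →
        pathDist (f x) y ≤ ((K + 2 + C : ℕ) : ℝ) + 2 := by
      intro x y h
      have h1 := hH.dist_triangle.trans (add_le_add (close x) h)
      have h2 : (H.dist (near (f x)) (near y) : ℝ) ≤ ((K + 2 + C : ℕ) : ℝ) := by exact_mod_cast h1
      linarith [pathDist_le_dist (f x) y]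
    exact ⟨_, fun t => (hC t).imp fun s h => key _ _ h, fun s => (hC2 s).imp fun t h => key _ _ h⟩

lemma GeodesicRay.eventually_notMem (r : GeodesicRay G) {F : Set V}
    (hF : F.Finite) : ∃ T : ℝ≥0, ∀ t, T < t → near (r.toFun t) ∉ F := by
  obtain ⟨B, hB⟩ := (hF.image fun v => G.dist (near (r.toFun 0)) v).bddAbove
  refine ⟨B + 2, fun t ht hmem => ?_⟩
  have h1 := hB ⟨_, hmem, rfl⟩
  have h2 := r.abs_le_dist 0 t
  simp only [NNReal.coe_zero, zero_sub, abs_neg, NNReal.abs_eq] at h2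
  have h3 : (G.dist (near (r.toFun 0)) (near (r.toFun t)) : ℝ) ≤ B := by exact_mod_cast h1
  have h4 : ((B + 2 : ℝ≥0) : ℝ) < t := ht
  push_cast at h4
  linarith

/-- An initial segment of `r` has bounded image, from which `r'` moves away. Hence the partners of
late points of `r'` are late points of `r`. -/
lemma Fellow.exists_late (hG : G.Connected) (hH : H.Connected) {β : V → W} {K : ℕ}
    (hβ : ∀ u v, H.dist (β u) (β v) ≤ K * G.dist u v) {r : GeodesicRay G}
    {r' : GeodesicRay H} (h : Fellow β r r') :
    ∃ C : ℕ, ∀ T : ℝ≥0, ∃ S : ℝ≥0, ∀ s, S < s →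
      ∃ t, T < t ∧ H.dist (β (near (r.toFun t))) (near (r'.toFun s)) ≤ C := by
  obtain ⟨C, -, hC⟩ := h
  refine ⟨C, fun T => ?_⟩
  set D := H.dist (near (r'.toFun 0)) (β (near (r.toFun 0))) with hD
  refine ⟨D + K * (T + 2) + C + 2, fun s hs => ?_⟩
  obtain ⟨t, ht⟩ := hC s
  refine ⟨t, ?_, ht⟩
  by_contra! hle
  have h1 := r'.abs_le_dist 0 s
  have h2 := r.dist_le_abs hG 0 t
  simp only [NNReal.coe_zero, zero_sub, abs_neg, NNReal.abs_eq] at h1 h2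
  have h3 := hH.dist_triangle (u := near (r'.toFun 0)) (v := β (near (r.toFun 0)))
    (w := near (r'.toFun s))
  have h4 := hH.dist_triangle (u := β (near (r.toFun 0))) (v := β (near (r.toFun t)))
    (w := near (r'.toFun s))
  have h5 : (H.dist (near (r'.toFun 0)) (near (r'.toFun s)) : ℝ) ≤
      D + (K * G.dist (near (r.toFun 0)) (near (r.toFun t)) + C) := by
    exact_mod_cast h3.trans (add_le_add_right (h4.trans (add_le_add (hβ _ _) ht)) _)
  have h6 : ((D + K * (T + 2) + C + 2 : ℝ≥0) : ℝ) < s := hs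
  have h7 : (t : ℝ) ≤ T := hle
  have h8 : (K : ℝ) * G.dist (near (r.toFun 0)) (near (r.toFun t)) ≤ K * (T + 2) :=
    mul_le_mul_of_nonneg_left (by linarith) (Nat.cast_nonneg _)
  push_cast at h6
  linarith

end Boundary

/-! ### Hyperbolic geodesics as coordinate axes -/

section HyperbolicLine

open UpperHalfPlane

-- The action is transitive, and the rotations about `I` can still be used to bring the second point
-- onto the imaginary axis.
open Matrix.SpecialLinearGroup in
lemma exists_smul_eq_I_re_eq_zero (a b : ℍ) :
    ∃ g : Matrix.SpecialLinearGroup (Fin 2) ℝ, g • a = UpperHalfPlane.I ∧ (g • b).re = 0 := by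
  obtain ⟨g, hg⟩ := MulAction.exists_smul_eq (Matrix.SpecialLinearGroup (Fin 2) ℝ) a UpperHalfPlane.I
  set w : ℍ := g • b with hw
  let k : ℝ → Matrix.SpecialLinearGroup (Fin 2) ℝ := fun θ =>
    ⟨!![Real.cos θ, Real.sin θ; -Real.sin θ, Real.cos θ], by
      rw [Matrix.det_fin_two_of]; nlinarith [Real.sin_sq_add_cos_sq θ]⟩
  have hk : ∀ θ (z : ℍ), ((k θ • z : ℍ) : ℂ) = (Real.cos θ * z + Real.sin θ) /
      (-Real.sin θ * z + Real.cos θ) := by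
    intro θ z
    rw [coe_specialLinearGroup_apply]
    simp [k]
  -- Up to a positive denominator `F θ` is the real part of `k θ • w`. It changes sign between `0`
  -- and `π / 2`, where the rotation is `z ↦ -1 / z`.
  let F : ℝ → ℝ := fun θ => (Real.cos θ * w.re + Real.sin θ) * (-Real.sin θ * w.re + Real.cos θ)
    - Real.cos θ * Real.sin θ * w.im ^ 2
  have hF : Continuous F := by fun_prop
  have hF0 : F 0 = w.re := by simp [F]
  have hF1 : F (Real.pi / 2) = -w.re := by simp [F]
  obtain ⟨θ, hθ⟩ : ∃ θ, F θ = 0 := by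
    rcases le_total w.re 0 with h | h
    · exact mem_range_of_exists_le_of_exists_ge hF ⟨0, by linarith⟩ ⟨Real.pi / 2, by linarith⟩
    · exact mem_range_of_exists_le_of_exists_ge hF ⟨Real.pi / 2, by linarith⟩ ⟨0, by linarith⟩
  refine ⟨k θ * g, ?_, ?_⟩
  · rw [mul_smul, hg]
    ext
    rw [hk, div_eq_iff]
    · simp only [coe_I]
      linear_combination (Real.sin θ : ℂ) * Complex.I_mul_I
    · intro h
      have h1 := congrArg Complex.re h
      have h2 := congrArg Complex.im h
      simp only [UpperHalfPlane.coe_I, Complex.add_re, Complex.add_im, Complex.mul_re,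
        Complex.mul_im, Complex.neg_re, Complex.neg_im, Complex.ofReal_re, Complex.ofReal_im,
        Complex.I_re, Complex.I_im, Complex.zero_re, Complex.zero_im] at h1 h2
      nlinarith [Real.sin_sq_add_cos_sq θ]
  · rw [mul_smul, ← hw, ← coe_re, hk, Complex.div_re]
    simp only [Complex.add_re, Complex.mul_re, Complex.ofReal_re, Complex.ofReal_im, coe_re,
      Complex.neg_re, Complex.neg_im, Complex.add_im, Complex.mul_im, coe_im]
    rw [← add_div]
    refine div_eq_zero_iff.2 (Or.inl ?_)
    refine Eq.trans ?_ hθ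
    simp only [F]
    ring

/-- Two points of the axis and the distances to them determine a point of the axis: combining the
two equations eliminates the real part, leaving a linear equation for the height. The use of `cosh`
makes the signs of `τ` and `τ - δ` irrelevant. -/
lemma eq_exp_of_dist {z w w' : ℍ} (hw : w = UpperHalfPlane.I) {δ τ : ℝ} (hδ : δ ≠ 0) (hre : w'.re = 0)
    (him : w'.im = Real.exp δ) (h : Real.cosh (dist z w) = Real.cosh τ)
    (h' : Real.cosh (dist z w') = Real.cosh (τ - δ)) : z.re = 0 ∧ z.im = Real.exp τ := by
  subst hw
  rw [cosh_dist', I_re, I_im, div_eq_iff (by have := z.im_pos; positivity), Real.cosh_eq] at h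
  rw [cosh_dist', hre, him, div_eq_iff (by have := z.im_pos; positivity), Real.cosh_eq, neg_sub,
    Real.exp_sub, Real.exp_sub] at h'
  rw [Real.exp_neg] at h
  have e1 := Real.exp_pos τ
  have e2 := Real.exp_pos δ
  have hne : Real.exp δ ^ 2 - 1 ≠ 0 := by
    intro h0
    have : Real.exp δ = 1 := by nlinarith
    exact hδ (by simpa using this)
  generalize Real.exp τ = A at *
  generalize Real.exp δ = B at *
  have hy : z.im = A := by
    have h3 : (B ^ 2 - 1) * (z.im - A) = 0 := by
      field_simp at h h'
      have : (B ^ 2 - 1) * (z.im - A) * A = 0 := by linear_combination A * h - A * h'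
      rcases mul_eq_zero.1 this with h | h
      · exact h
      · exact absurd h e1.ne'
    have := (mul_eq_zero.1 h3).resolve_left hne
    linarith
  refine ⟨?_, hy⟩
  rw [hy] at h
  field_simp at h
  nlinarith

/-- Every bi-infinite geodesic is moved by a Möbius transformation to the imaginary axis. -/
lemma exists_smul_isometry_eq {c : ℝ → ℍ} (hc : Isometry c) :
    ∃ (g : Matrix.SpecialLinearGroup (Fin 2) ℝ) (δ : ℝ), δ ≠ 0 ∧
      ∀ t, (g • c t).re = 0 ∧ (g • c t).im = Real.exp (δ * t) := by
  obtain ⟨g, h0, h1⟩ := exists_smul_eq_I_re_eq_zero (c 0) (c 1)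
  have hd : ∀ s t, dist (g • c s) (g • c t) = |s - t| := by
    intro s t
    rw [dist_smul, hc.dist_eq, Real.dist_eq]
  have hlog : |Real.log (g • c 1).im| = 1 := by
    have := hd 1 0
    rw [h0, dist_of_re_eq (by rw [h1, I_re]), I_im, Real.log_one, Real.dist_eq] at this
    simpa using this
  set δ := Real.log (g • c 1).im with hδ
  have hδ0 : δ ≠ 0 := by intro h; rw [h] at hlog; simp at hlog
  refine ⟨g, δ, hδ0, fun t => ?_⟩
  refine eq_exp_of_dist h0 hδ0 h1 (Real.exp_log (g • c 1).im_pos).symm ?_ ?_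
  · rw [hd, sub_zero, ← Real.cosh_abs (δ * t), abs_mul, hlog, one_mul]
  · rw [hd, ← Real.cosh_abs (δ * t - δ), ← mul_sub_one, abs_mul, hlog, one_mul]

/-- Coordinates on `ℍ` in which the imaginary axis is the first coordinate axis. -/
def axisCoordinates (δ : ℝ) (hδ : δ ≠ 0) : ℝ × ℝ ≃ₜ ℍ where
  toFun p := ⟨⟨Real.exp (δ * p.1) * p.2, Real.exp (δ * p.1)⟩, Real.exp_pos _⟩
  invFun z := (Real.log z.im / δ, z.re / z.im)
  left_inv p := by
    refine Prod.ext ?_ ?_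
    · change Real.log (Real.exp (δ * p.1)) / δ = p.1
      rw [Real.log_exp, mul_div_cancel_left₀ _ hδ]
    · change Real.exp (δ * p.1) * p.2 / Real.exp (δ * p.1) = p.2
      rw [mul_div_cancel_left₀ _ (Real.exp_pos _).ne']
  right_inv z := by
    ext
    simp only [mul_div_cancel₀ _ hδ, Real.exp_log z.im_pos, mul_div_cancel₀ _ z.im_ne_zero]
    rfl
  continuous_toFun := by
    refine Continuous.upperHalfPlaneMk ?_ _
    have : (fun p : ℝ × ℝ => (⟨Real.exp (δ * p.1) * p.2, Real.exp (δ * p.1)⟩ : ℂ)) =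
        fun p : ℝ × ℝ => ((Real.exp (δ * p.1) * p.2 : ℝ) : ℂ) +
          ((Real.exp (δ * p.1) : ℝ) : ℂ) * Complex.I := by
      funext p
      apply Complex.ext <;> simp only [Complex.add_re, Complex.add_im, Complex.mul_re,
        Complex.mul_im, Complex.ofReal_re, Complex.ofReal_im, Complex.I_re, Complex.I_im] <;> ring
    rw [this]
    fun_prop
  continuous_invFun := by
    refine ((continuous_im.log fun z => z.im_ne_zero).div_const δ).prodMk
      (continuous_re.div continuous_im fun z => z.im_ne_zero)

/-- Coordinates on `ℍ` in which a given geodesic is the first coordinate axis. -/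
theorem exists_lineCoordinates {c : ℝ → ℍ} (hc : Isometry c) :
    ∃ Ψ : ℝ × ℝ ≃ₜ ℍ, ∀ t, Ψ (t, 0) = c t := by
  obtain ⟨g, δ, hδ, h⟩ := exists_smul_isometry_eq hc
  refine ⟨(axisCoordinates δ hδ).trans (Homeomorph.smul g⁻¹), fun t => ?_⟩
  simp only [Homeomorph.trans_apply, Homeomorph.smul_apply]
  rw [inv_smul_eq_iff]
  ext
  apply Complex.ext
  · rw [coe_re, coe_re, (h t).1]; simp [axisCoordinates, ← coe_re]
  · rw [coe_im, coe_im, (h t).2]; simp [axisCoordinates, ← coe_im]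

end HyperbolicLine

/-! ### The Schwarz–Pick lemma on the upper half-plane -/

section SchwarzPick

lemma le_of_tanh_le {a b : ℝ} (h : Real.tanh a ≤ Real.tanh b) : a ≤ b := by
  by_contra! hlt
  have h1 : 0 < Real.sinh (a - b) := Real.sinh_pos_iff.2 (by linarith)
  rw [Real.sinh_sub] at h1
  rw [Real.tanh_eq_sinh_div_cosh, Real.tanh_eq_sinh_div_cosh,
    div_le_div_iff₀ (Real.cosh_pos _) (Real.cosh_pos _)] at h
  linarith

open ComplexConjugate in
/-- The Schwarz–Pick lemma. -/
theorem dist_le_of_differentiableOn {F : ℂ → ℂ} {φ : ℍ → ℍ}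
    (hF : DifferentiableOn ℂ F {z | 0 < z.im}) (hφ : ∀ z : ℍ, F z = φ z) (a b : ℍ) :
    dist (φ b) (φ a) ≤ dist b a := by
  have hden : ∀ (z p : ℍ), (z : ℂ) - conj (p : ℂ) ≠ 0 := by
    intro z p h
    have := congrArg Complex.im h
    simp at this
    have h1 := z.im_pos
    have h2 := p.im_pos
    linarith
  have hT : ∀ z p : ℍ, ‖((z : ℂ) - p) / (z - conj (p : ℂ))‖ = Real.tanh (dist z p / 2) := by
    intro z p
    rw [UpperHalfPlane.tanh_half_dist, norm_div, ← dist_eq_norm, ← dist_eq_norm]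
  have hT1 : ∀ z p : ℍ, ‖((z : ℂ) - p) / (z - conj (p : ℂ))‖ < 1 := by
    intro z p; rw [hT]; exact Real.tanh_lt_one _
  -- The inverse Cayley transform from the disc, taking `0` to `a`. Following `F` by the Cayley
  -- transform at `φ a` gives a self-map of the disc fixing `0`, and the moduli in the Schwarz lemma
  -- are `tanh` of half the hyperbolic distances.
  let S : ℂ → ℂ := fun w => (a - conj (a : ℂ) * w) / (1 - w)
  have h1w : ∀ w : ℂ, ‖w‖ < 1 → 1 - w ≠ 0 := by
    intro w hw h
    rw [← sub_eq_zero.1 h] at hw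
    simp at hw
  have hS : ∀ w : ℂ, ‖w‖ < 1 → 0 < (S w).im := by
    intro w hw
    have h2 : (S w).im = a.im * (1 - Complex.normSq w) / Complex.normSq (1 - w) := by
      simp only [S, Complex.div_im, ← sub_div]
      congr 1
      simp [Complex.normSq_apply]
      ring
    rw [h2]
    refine div_pos (mul_pos a.im_pos ?_) (Complex.normSq_pos.2 (h1w w hw))
    rw [Complex.normSq_eq_norm_sq]
    nlinarith [norm_nonneg w]
  let g : ℂ → ℂ := fun w => (F (S w) - φ a) / (F (S w) - conj (φ a : ℂ))
  have hFS : ∀ w (hw : ‖w‖ < 1), F (S w) = φ ⟨S w, hS w hw⟩ := fun w hw => hφ ⟨S w, hS w hw⟩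
  have hg : DifferentiableOn ℂ g (Metric.ball 0 1) := by
    have h1 : DifferentiableOn ℂ S (Metric.ball 0 1) := by
      intro w hw
      refine DifferentiableAt.differentiableWithinAt ?_
      have := h1w w (by simpa using hw)
      fun_prop (disch := assumption)
    have h2 : DifferentiableOn ℂ (fun w => F (S w)) (Metric.ball 0 1) :=
      hF.comp h1 fun w hw => hS w (by simpa using hw)
    refine (h2.sub_const _).div (h2.sub_const _) fun w hw => ?_
    rw [hFS w (by simpa using hw)]
    exact hden _ _
  have hmaps : MapsTo g (Metric.ball 0 1) (Metric.closedBall 0 1) := by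
    intro w hw
    have hw : ‖w‖ < 1 := by simpa using hw
    rw [mem_closedBall_zero_iff]
    simp only [g]
    rw [hFS w hw]
    exact (hT1 _ _).le
  have hS0 : S 0 = a := by simp [S]
  have hg0 : g 0 = 0 := by simp [g, hS0, hφ]
  set w : ℂ := ((b : ℂ) - a) / (b - conj (a : ℂ)) with hw
  have hSw : S w = b := by
    have h1 := h1w w (hT1 b a)
    rw [div_eq_iff h1, hw]
    have := hden b a
    field_simp
    ring
  have key := Complex.norm_le_norm_of_mapsTo_ball hg hmaps hg0 (hT1 b a)
  simp only [g] at key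
  rw [← hw, hSw, hφ, hT, hw, hT] at key
  have := le_of_tanh_le key
  linarith

end SchwarzPick

/-! ### Holomorphy of continuous lifts -/

section HolomorphicLift

lemma differentiableAt_of_comp_eq_of_deriv_ne_zero {ψ h₁ h₂ : ℂ → ℂ} {z : ℂ}
    (hψ : ContinuousAt ψ z) (h₂a : AnalyticAt ℂ h₂ (ψ z)) (hne : deriv h₂ (ψ z) ≠ 0)
    (h₁d : DifferentiableAt ℂ h₁ z) (heq : ∀ᶠ w in 𝓝 z, h₂ (ψ w) = h₁ w) :
    DifferentiableAt ℂ ψ z := by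
  have hs := h₂a.hasStrictDerivAt
  have hl := hs.eventually_left_inverse hne
  have hd := (hs.to_localInverse hne).hasDerivAt.differentiableAt
  rw [heq.self_of_nhds] at hd
  refine (hd.comp z h₁d).congr_of_eventuallyEq ?_
  filter_upwards [hψ.eventually hl, heq] with w hw hw'
  rw [Function.comp_apply, ← hw', hw]

/-- Local injectivity of `h₂` prevents its derivative from vanishing identically, so its zeros are
isolated. Off the point `z` the local inverse of `h₂` shows that `ψ` is differentiable, and
continuity removes the singularity at `z`. -/
lemma differentiableAt_of_comp_eq {ψ h₁ h₂ : ℂ → ℂ} {z : ℂ}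
    (hψ : ∀ᶠ w in 𝓝 z, ContinuousAt ψ w) (hψi : ∀ᶠ w in 𝓝[≠] z, ψ w ≠ ψ z)
    (h₂d : ∀ᶠ w in 𝓝 (ψ z), DifferentiableAt ℂ h₂ w)
    (h₂i : ∃ U ∈ 𝓝 (ψ z), InjOn h₂ U)
    (h₁d : ∀ᶠ w in 𝓝 z, DifferentiableAt ℂ h₁ w) (heq : ∀ᶠ w in 𝓝 z, h₂ (ψ w) = h₁ w) :
    DifferentiableAt ℂ ψ z := by
  have han : AnalyticAt ℂ h₂ (ψ z) := Complex.analyticAt_iff_eventually_differentiableAt.2 h₂d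
  have hev : ∀ᶠ w in 𝓝[≠] (ψ z), deriv h₂ w ≠ 0 := by
    refine han.deriv.eventually_eq_zero_or_eventually_ne_zero.resolve_left fun h0 => ?_
    obtain ⟨U, hU, hinj⟩ := h₂i
    obtain ⟨ε, hε, hball⟩ := Metric.mem_nhds_iff.1 (inter_mem (inter_mem h0 h₂d) hU)
    have hmem : ψ z + (ε / 2 : ℝ) ∈ Metric.ball (ψ z) ε := by
      rw [Metric.mem_ball, dist_self_add_left, Complex.norm_real, Real.norm_eq_abs,
        abs_of_pos (by linarith)]
      linarith
    have hc := IsOpen.is_const_of_deriv_eq_zero Metric.isOpen_ball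
      (convex_ball (ψ z) ε).isPreconnected (f := h₂)
      (fun w hw => (hball hw).1.2.differentiableWithinAt) (fun w hw => (hball hw).1.1)
      (Metric.mem_ball_self hε) hmem
    have := hinj (hball (Metric.mem_ball_self hε)).2 (hball hmem).2 hc
    simp at this
    linarith
  refine (Complex.analyticAt_of_differentiable_on_punctured_nhds_of_continuousAt ?_
    hψ.self_of_nhds).differentiableAt
  have htend : Tendsto ψ (𝓝[≠] z) (𝓝[≠] (ψ z)) :=
    tendsto_nhdsWithin_iff.2 ⟨hψ.self_of_nhds.tendsto.mono_left nhdsWithin_le_nhds, hψi⟩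
  have h₂a : ∀ᶠ w in 𝓝 (ψ z), AnalyticAt ℂ h₂ w := han.eventually_analyticAt
  filter_upwards [htend.eventually hev, htend.eventually (nhdsWithin_le_nhds h₂a),
    nhdsWithin_le_nhds hψ, nhdsWithin_le_nhds h₁d,
    nhdsWithin_le_nhds (eventually_eventually_nhds.2 heq)] with w h1 h2 h3 h4 h5
  exact differentiableAt_of_comp_eq_of_deriv_ne_zero h3 h2 h1 h4 h5

end HolomorphicLift

/-! ### Deck transformations -/

section Deck

variable {Y : Type*} [TopologicalSpace Y] {S : Set Y}

/-- The group of deck transformations. -/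
def deck (π : C(ℍ, (Sᶜ : Set Y))) : Subgroup (ℍ ≃ₜ ℍ) where
  carrier := {φ | ∀ w, π (φ w) = π w}
  mul_mem' {φ ψ} hφ hψ w := (hφ (ψ w)).trans (hψ w)
  one_mem' _ := rfl
  inv_mem' {φ} hφ w := by
    have := hφ (φ⁻¹ w)
    rwa [show φ (φ⁻¹ w) = w from φ.apply_symm_apply w, eq_comm] at this

variable {π : C(ℍ, (Sᶜ : Set Y))}

instance : MulAction (deck π) ℍ where
  smul φ w := φ.1 w
  one_smul _ := rfl
  mul_smul _ _ _ := rfl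

lemma deck_smul_def (φ : deck π) (w : ℍ) : φ • w = φ.1 w := rfl

instance : ContinuousConstSMul (deck π) ℍ := ⟨fun φ => φ.1.continuous⟩

@[simp] lemma proj_smul (φ : deck π) (w : ℍ) : π (φ • w) = π w := φ.2 w

lemma deck_eq_of_smul_eq (hcov : IsCoveringMap π) {φ ψ : deck π} {w : ℍ} (h : φ • w = ψ • w) :
    φ = ψ := by
  refine Subtype.ext (Homeomorph.ext fun x => congrFun ?_ x)
  exact hcov.eq_of_comp_eq φ.1.continuous ψ.1.continuous
    (funext fun x => (φ.2 x).trans (ψ.2 x).symm) w h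

/-- As `ℍ` is simply connected, `π` lifts through itself with either choice of base values; by
uniqueness of lifts the two lifts are mutually inverse. -/
lemma exists_deck_smul_eq (hcov : IsCoveringMap π) {w w' : ℍ} (h : π w = π w') :
    ∃ φ : deck π, φ • w = w' := by
  obtain ⟨F, ⟨hF, hF'⟩, -⟩ := hcov.existsUnique_continuousMap_lifts π w w' h.symm
  obtain ⟨G, ⟨hG, hG'⟩, -⟩ := hcov.existsUnique_continuousMap_lifts π w' w h
  have h1 : G ∘ F = id := hcov.eq_of_comp_eq (by fun_prop) continuous_id
    (by rw [← Function.comp_assoc, hG', hF', Function.comp_id]) w (by simp [hF, hG])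
  have h2 : F ∘ G = id := hcov.eq_of_comp_eq (by fun_prop) continuous_id
    (by rw [← Function.comp_assoc, hF', hG', Function.comp_id]) w' (by simp [hF, hG])
  exact ⟨⟨⟨⟨F, G, congrFun h1, congrFun h2⟩, F.continuous, G.continuous⟩, congrFun hF'⟩, hF⟩

lemma isOpen_setOf_smul_eq (hcov : IsCoveringMap π) {A : Type*} [TopologicalSpace A] {a b : A → ℍ}
    (ha : Continuous a) (hb : Continuous b) (h : ∀ x, π (a x) = π (b x)) (φ : deck π) :
    IsOpen {x | φ • a x = b x} :=
  hcov.isLocalHomeomorph.isLocallyInjective.isOpen_eqLocus (ha.const_smul φ) hb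
    (funext fun x => (proj_smul φ (a x)).trans (h x))

-- In a chart of the surface a deck transformation is a continuous lift of a holomorphic map through
-- the same map, hence holomorphic. Schwarz–Pick for it and for its inverse gives equality of
-- distances.
open UpperHalfPlane in
lemma deck_isometry [ChartedSpace ℂ Y] [IsManifold 𝓘(ℂ) ω Y] (hcov : IsCoveringMap π)
    (hhol : MDifferentiable 𝓘(ℂ) 𝓘(ℂ) (fun w : ℍ => (π w : Y))) (φ : deck π) :
    Isometry (φ • · : ℍ → ℍ) := by
  have key : ∀ (φ : deck π) (a b : ℍ), dist (φ • b) (φ • a) ≤ dist b a := by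
    intro φ
    have hopen := isOpen_upperHalfPlaneSet
    refine dist_le_of_differentiableOn (F := fun z => (φ • (ofComplex z : ℍ) : ℍ)) ?_
      (fun z => by rw [ofComplex_apply])
    intro z₀ hz₀
    refine DifferentiableAt.differentiableWithinAt ?_
    have : IsManifold 𝓘(ℂ) 1 Y := IsManifold.of_le (n := ω) le_top
    set w₀ : ℍ := ofComplex z₀ with hw₀
    have hw₀z : (w₀ : ℂ) = z₀ := by rw [hw₀, ofComplex_apply_of_im_pos hz₀]
    set e := chartAt ℂ (π w₀ : Y) with he
    set h : ℂ → ℂ := fun z => e (π (ofComplex z) : Y) with hh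
    have hd : ∀ w : ℍ, π w = π w₀ → ∀ᶠ z in 𝓝 (w : ℂ), DifferentiableAt ℂ h z := by
      intro w hw
      have hopen' : IsOpen {w : ℍ | (π w : Y) ∈ e.source} :=
        e.open_source.preimage (continuous_subtype_val.comp π.continuous)
      have hmem : {w : ℍ | (π w : Y) ∈ e.source} ∈ 𝓝 w := hopen'.mem_nhds (by
        change (π w : Y) ∈ e.source
        rw [hw]; exact mem_chart_source ℂ _)
      have := isOpenEmbedding_coe.image_mem_nhds.2 hmem
      filter_upwards [this]
      rintro _ ⟨v, hv, rfl⟩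
      have h0 : MDifferentiableAt 𝓘(ℂ) 𝓘(ℂ) e (π v : Y) :=
        mdifferentiableAt_atlas (chart_mem_atlas ℂ (π w₀ : Y)) hv
      have h1 : MDifferentiableAt 𝓘(ℂ) 𝓘(ℂ) (fun w : ℍ => e (π w : Y)) v :=
        h0.comp v (hhol v)
      exact mdifferentiableAt_iff.1 h1
    have hφw : ((φ • w₀ : ℍ) : ℂ) = (fun z => ((φ • (ofComplex z : ℍ) : ℍ) : ℂ)) z₀ := rfl
    refine differentiableAt_of_comp_eq (h₁ := h) (h₂ := h) ?_ ?_ ?_ ?_ ?_ ?_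
    · filter_upwards [hopen.mem_nhds hz₀] with z hz
      exact (UpperHalfPlane.continuous_coe.comp (φ.1.continuous)).continuousAt.comp
        (mdifferentiableAt_ofComplex hz).continuousAt
    · filter_upwards [self_mem_nhdsWithin, nhdsWithin_le_nhds (hopen.mem_nhds hz₀)] with z hz hz'
      intro heq
      have h1 := smul_left_cancel φ (UpperHalfPlane.ext heq)
      have h2 := congrArg UpperHalfPlane.coe h1
      rw [ofComplex_apply_of_im_pos hz', ofComplex_apply_of_im_pos hz₀] at h2
      exact hz h2
    · exact hd _ (proj_smul _ _)
    · obtain ⟨f, hf, hf'⟩ := hcov.isLocalHomeomorph (φ • w₀)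
      have hopen' : IsOpen {w : ℍ | (π w : Y) ∈ e.source} :=
        e.open_source.preimage (continuous_subtype_val.comp π.continuous)
      have hmem : f.source ∩ {w : ℍ | (π w : Y) ∈ e.source} ∈ 𝓝 (φ • w₀) :=
        (f.open_source.inter hopen').mem_nhds ⟨hf, by
          change (π (φ • w₀) : Y) ∈ e.source
          rw [proj_smul]; exact mem_chart_source ℂ _⟩
      refine ⟨_, isOpenEmbedding_coe.image_mem_nhds.2 hmem, ?_⟩
      rintro _ ⟨v, hv, rfl⟩ _ ⟨v', hv', rfl⟩ heq
      simp only [hh, ofComplex_apply] at heq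
      have h1 := Subtype.ext (e.injOn hv.2 hv'.2 heq)
      rw [hf'] at h1
      rw [f.injOn hv.1 hv'.1 h1]
    · rw [← hw₀z]; exact hd _ rfl
    · filter_upwards with z
      simp only [hh, ofComplex_apply, proj_smul]
  refine Isometry.of_dist_eq fun a b => le_antisymm (key φ b a) ?_
  have := key φ⁻¹ (φ • b) (φ • a)
  rwa [inv_smul_smul, inv_smul_smul] at this

/-- The deck group acts properly discontinuously. -/
lemma finite_setOf_smul_inter [T2Space Y] (hcov : IsCoveringMap π)
    (hiso : ∀ φ : deck π, Isometry (φ • · : ℍ → ℍ)) {K L : Set ℍ} (hK : IsCompact K)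
    (hL : IsCompact L) : {φ : deck π | ∃ x ∈ K, φ • x ∈ L}.Finite := by
  obtain ⟨R, hR⟩ := (hK.union hL).isBounded.subset_closedBall UpperHalfPlane.I
  set z := UpperHalfPlane.I
  have hfib : (π ⁻¹' {π z} ∩ Metric.closedBall z (2 * R)).Finite := by
    have hcl : IsClosed (π ⁻¹' {π z}) := isClosed_singleton.preimage π.continuous
    have hdis : DiscreteTopology (π ⁻¹' {π z}) := (hcov (π z)).discreteTopology_fiber
    refine ((isCompact_closedBall z (2 * R)).inter_left hcl).finite ?_
    exact IsDiscrete.mono (isDiscrete_iff_discreteTopology.2 hdis) inter_subset_left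
  -- A deck transformation is determined by its value at `z`, and the triangle inequality puts that
  -- value in the finite part of the fibre within distance `2 * R`.
  refine Finite.of_finite_image (f := fun φ : deck π => φ • z) (hfib.subset ?_)
    (fun φ _ ψ _ h => deck_eq_of_smul_eq hcov h)
  rintro _ ⟨φ, ⟨x, hx, hφx⟩, rfl⟩
  refine ⟨proj_smul φ z, ?_⟩
  have h1 : dist x z ≤ R := hR (Or.inl hx)
  have h2 : dist (φ • x) z ≤ R := hR (Or.inr hφx)
  have h3 : dist (φ • z) (φ • x) = dist z x := (hiso φ).dist_eq z x
  have h4 := dist_triangle (φ • z) (φ • x) z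
  rw [Metric.mem_closedBall]
  rw [dist_comm z x] at h3
  linarith

end Deck

/-! ### The deck group and the fundamental group -/

section DeckClass

variable {Y : Type*} [TopologicalSpace Y] {S : Set Y} {π : C(ℍ, (Sᶜ : Set Y))}

namespace CutSystem

variable (E : CutSystem π)

lemma projClass_eq {w : ℍ} (h : π w = π E.z) (α β : Path E.z w) :
    E.projClass h α = E.projClass h β := by
  unfold projClass loopClass
  congr 2
  exact Path.Homotopic.Quotient.eq.2
    ((SimplyConnectedSpace.paths_homotopic α β).map π)

/-- The element of the fundamental group that acts on `ℍ` as a given deck transformation. -/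
def deckClass (φ : deck π) : E.group :=
  E.projClass (φ.2 E.z) (PathConnectedSpace.somePath E.z (φ • E.z))

lemma deckClass_eq (φ : deck π) (α : Path E.z (φ • E.z)) (h : π (φ • E.z) = π E.z) :
    E.deckClass φ = E.projClass h α :=
  E.projClass_eq _ _ _

lemma isDeck_deckClass (φ : deck π) : E.IsDeck (E.deckClass φ) φ.1 :=
  ⟨φ.2, _, rfl⟩

lemma loopClass_trans {X : Type*} [TopologicalSpace X] {p : X} (α β : Path p p) :
    loopClass (α.trans β) = loopClass α * loopClass β := rfl

/-- A path to `(φ * ψ) • z` is a path to `φ • z` followed by the `φ`-translate of a path to `ψ • z`,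
and the translate has the same projection. With loops read from left to right this is a
homomorphism. -/
lemma deckClass_mul (φ ψ : deck π) : E.deckClass (φ * ψ) = E.deckClass φ * E.deckClass ψ := by
  let α := PathConnectedSpace.somePath E.z (φ • E.z)
  let β := PathConnectedSpace.somePath E.z (ψ • E.z)
  rw [E.deckClass_eq (φ * ψ) (α.trans (β.map φ.1.continuous)) (proj_smul _ _),
    E.deckClass_eq φ α (proj_smul _ _), E.deckClass_eq ψ β (proj_smul _ _)]
  unfold projClass
  rw [← loopClass_trans]
  congr 1
  ext t
  refine (congrArg (fun x => (π x : Y))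
    (Path.trans_apply α (β.map φ.1.continuous) t)).trans ?_
  simp only [Path.cast_coe, Path.map_coe, Function.comp_apply, Path.trans_apply]
  split_ifs
  · rfl
  · exact congrArg _ (φ.2 _)

lemma deckClass_injective (hcov : IsCoveringMap π) : Function.Injective E.deckClass := by
  intro φ ψ h
  refine deck_eq_of_smul_eq hcov (w := E.z) ?_
  unfold deckClass projClass loopClass at h
  have h1 := Path.Homotopic.Quotient.exact (MulOpposite.op_injective h)
  have h2 := hcov.liftPath_apply_one_eq_of_homotopicRel h1 E.z (by simp) (by simp)
  have h3 : ∀ χ : deck π, ∀ (H : _ = _),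
      hcov.liftPath ((((PathConnectedSpace.somePath E.z (χ • E.z)).map π.continuous).cast rfl
        (χ.2 E.z).symm : Path (π E.z) (π E.z)) : C(I, _)) E.z H 1 = χ • E.z := by
    intro χ H
    rw [← (hcov.eq_liftPath_iff' H (Γ := (PathConnectedSpace.somePath E.z (χ • E.z) : C(I, ℍ)))).2
      ⟨rfl, by simp⟩]
    simp
  rw [← h3 φ (by simp), ← h3 ψ (by simp)]
  exact h2

lemma deckClass_surjective (hcov : IsCoveringMap π) : Function.Surjective E.deckClass := by
  intro γ
  obtain ⟨γ, rfl⟩ := MulOpposite.op_surjective γ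
  obtain ⟨p, rfl⟩ := Path.Homotopic.Quotient.mk_surjective γ
  let Γ := hcov.liftPath p E.z (by simp)
  have hΓ : π ∘ Γ = p := hcov.liftPath_lifts p E.z (by simp)
  have hΓ0 : Γ 0 = E.z := hcov.liftPath_zero p E.z (by simp)
  obtain ⟨φ, hφ⟩ := exists_deck_smul_eq hcov (w := E.z) (w' := Γ 1)
    (by rw [show π (Γ 1) = p 1 from congrFun hΓ 1]; simp)
  refine ⟨φ, ?_⟩
  rw [E.deckClass_eq φ ⟨Γ, hΓ0, hφ.symm⟩ (proj_smul _ _)]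
  unfold projClass loopClass
  congr 3
  ext t
  exact congrArg Subtype.val (congrFun hΓ t)

/-- The identification of the deck group with the fundamental group. -/
def deckEquiv (hcov : IsCoveringMap π) : deck π ≃* E.group :=
  MulEquiv.ofBijective (MulHom.mk E.deckClass E.deckClass_mul)
    ⟨E.deckClass_injective hcov, E.deckClass_surjective hcov⟩

lemma changeBasepoint_loopClass {X : Type*} [TopologicalSpace X] {p q : X} (c : Path p q)
    (α : Path p p) : changeBasepoint c (loopClass α) = loopClass (c.symm.trans (α.trans c)) := rfl

/-- The conjugated loop lifts to a path from `E₂.z` through `E₁.z` and `φ • E₁.z` to `φ • E₂.z`; the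
last piece is the `φ`-translate of `c`. So the change of basepoint is the identity on deck
transformations. -/
lemma change_deckClass {E₁ E₂ : CutSystem π} (c : Path E₁.z E₂.z) (φ : deck π) :
    change E₁ E₂ c (E₁.deckClass φ) = E₂.deckClass φ := by
  let α := PathConnectedSpace.somePath E₁.z (φ • E₁.z)
  rw [E₁.deckClass_eq φ α (proj_smul _ _),
    E₂.deckClass_eq φ (c.symm.trans (α.trans (c.map φ.1.continuous))) (proj_smul _ _)]
  unfold projClass change
  rw [changeBasepoint_loopClass]
  congr 1
  ext t
  simp only [Path.cast_coe, Path.map_coe, Function.comp_apply, Path.trans_apply, Path.symm_apply]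
  split_ifs
  · rfl
  · rfl
  · exact congrArg _ (φ.2 _).symm

end CutSystem

end DeckClass

/-! ### The tiling of the half-plane by lifts of the cut surface -/

section Tiling

variable {Y : Type*} [TopologicalSpace Y] {S : Set Y} {π : C(ℍ, (Sᶜ : Set Y))}

/-- The image of a compact set is closed and avoids the punctures, whereas both ends of the geodesic
tend to punctures; only a bounded range of times remains. -/
lemma IsIdealGeodesic.isCompact_preimage [T2Space Y] {c : ℝ → ℍ} (hc : IsIdealGeodesic π c)
    {K : Set ℍ} (hK : IsCompact K) : IsCompact {t | π (c t) ∈ π '' K} := by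
  obtain ⟨hiso, ⟨q, hq, htop⟩, q', hq', hbot⟩ := hc
  have hcompact : IsCompact ((fun w => (π w : Y)) '' K) :=
    hK.image (continuous_subtype_val.comp π.continuous)
  have hopen : IsOpen ((fun w => (π w : Y)) '' K)ᶜ := hcompact.isClosed.isOpen_compl
  have hmem : ∀ q ∈ S, q ∈ ((fun w => (π w : Y)) '' K)ᶜ := by
    rintro q hq ⟨w, -, rfl⟩
    exact (π w).2 hq
  obtain ⟨b, hb⟩ := eventually_atTop.1 (htop.eventually (hopen.mem_nhds (hmem q hq)))
  obtain ⟨a, ha⟩ := eventually_atBot.1 (hbot.eventually (hopen.mem_nhds (hmem q' hq')))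
  have hcl : IsClosed {t | π (c t) ∈ π '' K} :=
    (hK.image π.continuous).isClosed.preimage (π.continuous.comp hiso.continuous)
  refine isCompact_Icc (a := a) (b := b) |>.of_isClosed_subset hcl ?_
  rintro t ⟨w, hw, hwt⟩
  have hin : (π (c t) : Y) ∈ (fun w => (π w : Y)) '' K := ⟨w, hw, congrArg Subtype.val hwt⟩
  constructor
  · by_contra! hlt
    exact ha t hlt.le hin
  · by_contra! hlt
    exact hb t hlt.le hin

lemma IsIdealGeodesic.finite_setOf_smul_mem [T2Space Y] (hcov : IsCoveringMap π)
    (hiso : ∀ φ : deck π, Isometry (φ • · : ℍ → ℍ)) {c : ℝ → ℍ} (hc : IsIdealGeodesic π c)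
    {K : Set ℍ} (hK : IsCompact K) : {φ : deck π | ∃ t, φ • c t ∈ K}.Finite := by
  have hL := (hc.isCompact_preimage hK).image hc.1.continuous
  refine (finite_setOf_smul_inter hcov hiso hL hK).subset ?_
  rintro φ ⟨t, ht⟩
  exact ⟨c t, ⟨t, ⟨_, ht, proj_smul _ _⟩, rfl⟩, ht⟩

lemma IsIdealGeodesic.smul (hiso : ∀ φ : deck π, Isometry (φ • · : ℍ → ℍ)) {c : ℝ → ℍ}
    (hc : IsIdealGeodesic π c) (φ : deck π) : IsIdealGeodesic π fun t => φ • c t := by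
  obtain ⟨h1, h2, h3⟩ := hc
  exact ⟨(hiso φ).comp h1, by simpa only [proj_smul] using h2, by simpa only [proj_smul] using h3⟩

/-- Used for labels such as tiles and sides, whose values carry no topology of their own. -/
lemma IsPreconnected.eq_of_eventually_eq {A B : Type*} [TopologicalSpace A] {s : Set A}
    (hs : IsPreconnected s) {f : A → B} (h : ∀ x ∈ s, ∀ᶠ y in 𝓝[s] x, f y = f x) {x y : A}
    (hx : x ∈ s) (hy : y ∈ s) : f x = f y := by
  let : TopologicalSpace B := ⊥
  have : DiscreteTopology B := ⟨rfl⟩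
  refine hs.constant (f := f) (fun a ha => ?_) hx hy
  exact tendsto_nhds_of_eventually_eq (h a ha)

namespace CutSystem

variable (E : CutSystem π)

/-- The union of all lifts of the arcs. -/
def walls : Set ℍ := π ⁻¹' ⋃ i, E.arc i

lemma smul_mem_walls {E : CutSystem π} {φ : deck π} {w : ℍ} : φ • w ∈ E.walls ↔ w ∈ E.walls := by
  simp [walls]

/-- The tiling of `ℍ` by the lifts of the complement of the arcs: each lift of an arc is the first
axis of a coordinate system of `ℍ`, and near that lift, each side of it belongs to one tile. -/
structure Tiling where
  chart : Fin E.k → ℝ × ℝ ≃ₜ ℍ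
  ideal : ∀ i, IsIdealGeodesic π fun t => chart i (t, 0)
  injective : ∀ i, Function.Injective fun t => π (chart i (t, 0))
  range_eq : ∀ i, range (fun t => π (chart i (t, 0))) = E.arc i
  isClosed_walls : IsClosed E.walls
  tile : ℍ → deck π
  tile_smul : ∀ (v : deck π) (w : ℍ), w ∉ E.walls → tile (v • w) = v * tile w
  tile_base : tile E.z = 1
  eventually_tile_eq : ∀ w ∉ E.walls, ∀ᶠ w' in 𝓝 w, tile w' = tile w
  isPathConnected : ∀ v, IsPathConnected {w | w ∉ E.walls ∧ tile w = v}
  pos : Fin E.k → deck π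
  neg : Fin E.k → deck π
  pos_spec : ∀ i t, ∀ᶠ p in 𝓝 ((t, 0) : ℝ × ℝ), 0 < p.2 →
    chart i p ∉ E.walls ∧ tile (chart i p) = pos i
  neg_spec : ∀ i t, ∀ᶠ p in 𝓝 ((t, 0) : ℝ × ℝ), p.2 < 0 →
    chart i p ∉ E.walls ∧ tile (chart i p) = neg i

section Existence

variable {E} {c : Fin E.k → ℝ → ℍ}

lemma mem_walls_iff (hcov : IsCoveringMap π)
    (hrange : ∀ i, range (fun t => π (c i t)) = E.arc i) {w : ℍ} :
    w ∈ E.walls ↔ ∃ (p : Fin E.k × deck π) (t : ℝ), p.2 • c p.1 t = w := by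
  constructor
  · intro hw
    obtain ⟨i, hi⟩ := mem_iUnion.1 hw
    rw [← hrange] at hi
    obtain ⟨t, ht⟩ := hi
    obtain ⟨φ, hφ⟩ := exists_deck_smul_eq hcov ht
    exact ⟨(i, φ), t, hφ⟩
  · rintro ⟨⟨i, φ⟩, t, rfl⟩
    refine mem_iUnion.2 ⟨i, ?_⟩
    rw [proj_smul, ← hrange]
    exact ⟨t, rfl⟩

lemma smul_line_inj (hcov : IsCoveringMap π)
    (hinj : ∀ i, Function.Injective fun t => π (c i t))
    (hrange : ∀ i, range (fun t => π (c i t)) = E.arc i) {p p' : Fin E.k × deck π} {t t' : ℝ}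
    (h : p.2 • c p.1 t = p'.2 • c p'.1 t') : p = p' ∧ t = t' := by
  obtain ⟨i, φ⟩ := p
  obtain ⟨i', φ'⟩ := p'
  have h1 : π (c i t) = π (c i' t') := by
    simpa using congrArg π h
  have hi : i = i' := by
    by_contra hne
    have hd : Disjoint (E.arc i) (E.arc i') := E.disjoint hne
    rw [← hrange, ← hrange] at hd
    exact Set.disjoint_left.1 hd ⟨t, rfl⟩ ⟨t', h1.symm⟩
  subst hi
  have ht := hinj i h1
  subst ht
  exact ⟨Prod.ext rfl (deck_eq_of_smul_eq hcov h), rfl⟩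

lemma locallyFinite_lines [T2Space Y] (hcov : IsCoveringMap π)
    (hiso : ∀ φ : deck π, Isometry (φ • · : ℍ → ℍ)) (hc : ∀ i, IsIdealGeodesic π (c i)) :
    LocallyFinite fun p : Fin E.k × deck π => range fun t => p.2 • c p.1 t := by
  intro x
  refine ⟨_, Metric.closedBall_mem_nhds x one_pos, ?_⟩
  have hfin : (⋃ i : Fin E.k, (fun φ : deck π => (i, φ)) ''
      {φ : deck π | ∃ t, φ • c i t ∈ Metric.closedBall x 1}).Finite :=
    finite_iUnion fun i =>
      ((hc i).finite_setOf_smul_mem hcov hiso (isCompact_closedBall x 1)).image _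
  refine hfin.subset ?_
  rintro ⟨i, φ⟩ ⟨_, ⟨t, rfl⟩, ht⟩
  exact mem_iUnion.2 ⟨i, φ, ⟨t, ht⟩, rfl⟩

lemma isClosed_range_line (hiso : ∀ φ : deck π, Isometry (φ • · : ℍ → ℍ))
    (hc : ∀ i, IsIdealGeodesic π (c i)) (p : Fin E.k × deck π) :
    IsClosed (range fun t => p.2 • c p.1 t) :=
  ((hc p.1).smul hiso p.2).1.isClosedEmbedding.isClosed_range

lemma isClosed_walls_of_lines [T2Space Y] (hcov : IsCoveringMap π)
    (hiso : ∀ φ : deck π, Isometry (φ • · : ℍ → ℍ)) (hc : ∀ i, IsIdealGeodesic π (c i))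
    (hrange : ∀ i, range (fun t => π (c i t)) = E.arc i) : IsClosed E.walls := by
  have : E.walls = ⋃ p : Fin E.k × deck π, range fun t => p.2 • c p.1 t := by
    ext w
    rw [mem_walls_iff hcov hrange]
    simp
  rw [this]
  exact (locallyFinite_lines hcov hiso hc).isClosed_iUnion (isClosed_range_line hiso hc)

/-- The tile of a point off the walls. -/
lemma exists_tile (hcov : IsCoveringMap π) (hsurj : Function.Surjective π)
    (hclosed : IsClosed E.walls) :
    ∃ tile : ℍ → deck π, (∀ (v : deck π) (w : ℍ), w ∉ E.walls → tile (v • w) = v * tile w) ∧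
      tile E.z = 1 ∧ (∀ w ∉ E.walls, ∀ᶠ w' in 𝓝 w, tile w' = tile w) ∧
      ∀ v, IsPathConnected {w | w ∉ E.walls ∧ tile w = v} := by
  classical
  have hq := hcov.isQuotientMap hsurj
  have hopen : IsOpen ((⋃ i, E.arc i)ᶜ : Set (Sᶜ : Set Y)) := by
    rw [← hq.isOpen_preimage]
    exact hclosed.isOpen_compl
  have : LocallyPathConnectedSpace (Sᶜ : Set Y) := hq.locallyPathConnectedSpace
  have : LocallyPathConnectedSpace ((⋃ i, E.arc i)ᶜ : Set (Sᶜ : Set Y)) :=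
    hopen.locallyPathConnectedSpace
  have := E.simplyConnected
  -- Simple connectedness of the complement gives a section `s` over it with value `E.z` at the
  -- basepoint. The tile of `w` is the deck transformation that carries `s (π w)` to `w`, so the
  -- tiles are the translates of the range of `s`.
  obtain ⟨s, ⟨hsz, hs⟩, -⟩ := hcov.existsUnique_continuousMap_lifts
    (⟨Subtype.val, continuous_subtype_val⟩ : C(((⋃ i, E.arc i)ᶜ : Set (Sᶜ : Set Y)), _))
    ⟨π E.z, E.notMem⟩ E.z rfl
  have hs' : ∀ x, π (s x) = x.1 := fun x => congrFun hs x
  let a : {w // w ∉ E.walls} → ℍ := fun w => s ⟨π w.1, w.2⟩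
  have ha : Continuous a :=
    s.continuous.comp ((π.continuous.comp continuous_subtype_val).subtype_mk _)
  have hex : ∀ w : {w // w ∉ E.walls}, ∃ φ : deck π, φ • a w = w.1 := fun w =>
    exists_deck_smul_eq hcov (hs' _)
  choose τ hτ using hex
  have hτu : ∀ w (φ : deck π), φ • a w = w.1 → τ w = φ := fun w φ h =>
    deck_eq_of_smul_eq hcov ((hτ w).trans h.symm)
  have hsw : ∀ x (v : deck π), v • s x ∉ E.walls := by
    intro x v
    rw [smul_mem_walls]
    change π (s x) ∉ ⋃ i, E.arc i
    rw [hs']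
    exact x.2
  have ha' : ∀ x (v : deck π) (h : v • s x ∉ E.walls), a ⟨v • s x, h⟩ = s x := by
    intro x v h
    refine congrArg s (Subtype.ext ?_)
    change π (v • s x) = x.1
    rw [proj_smul, hs']
  let tile : ℍ → deck π := fun w => if h : w ∉ E.walls then τ ⟨w, h⟩ else 1
  have htile : ∀ w (h : w ∉ E.walls), tile w = τ ⟨w, h⟩ := fun w h => dif_pos h
  have hcharts : ∀ w (h : w ∉ E.walls), tile w • a ⟨w, h⟩ = w := by
    intro w h; rw [htile w h]; exact hτ ⟨w, h⟩
  refine ⟨tile, ?_, ?_, ?_, ?_⟩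
  · intro v w hw
    have hvw : v • w ∉ E.walls := fun h => hw (smul_mem_walls.1 h)
    rw [htile _ hvw]
    refine hτu _ _ ?_
    have : a ⟨v • w, hvw⟩ = a ⟨w, hw⟩ := congrArg s (Subtype.ext (proj_smul v w))
    rw [this, mul_smul, hcharts]
  · rw [htile E.z E.notMem]
    exact hτu _ _ (by rw [one_smul]; exact hsz)
  · intro w hw
    have h1 := (isOpen_setOf_smul_eq hcov ha continuous_subtype_val (fun x => hs' _)
      (tile w)).mem_nhds (x := ⟨w, hw⟩) (hcharts w hw)
    have h2 := hclosed.isOpen_compl.isOpenEmbedding_subtypeVal.image_mem_nhds.2 h1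
    filter_upwards [h2]
    rintro _ ⟨⟨w', hw'⟩, h, rfl⟩
    rw [htile w' hw']
    exact hτu _ _ h
  · intro v
    have : {w | w ∉ E.walls ∧ tile w = v} = range fun x => v • s x := by
      ext w
      constructor
      · rintro ⟨hw, rfl⟩
        exact ⟨_, hcharts w hw⟩
      · rintro ⟨x, rfl⟩
        refine ⟨hsw x v, ?_⟩
        change tile (v • s x) = v
        rw [htile _ (hsw x v)]
        exact hτu _ _ (by rw [ha'])
    rw [this]
    exact isPathConnected_range (s.continuous.const_smul v)

/-- Near a line, each side of it belongs to a single tile. -/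
lemma exists_side_tile (Ψ : ℝ × ℝ ≃ₜ ℍ)
    {tile : ℍ → deck π} (htile : ∀ w ∉ E.walls, ∀ᶠ w' in 𝓝 w, tile w' = tile w)
    (hline : ∀ t, ∀ᶠ p in 𝓝 ((t, 0) : ℝ × ℝ), p.2 ≠ 0 → Ψ p ∉ E.walls) :
    ∃ τ : deck π, ∀ t, ∀ᶠ p in 𝓝 ((t, 0) : ℝ × ℝ), 0 < p.2 →
      Ψ p ∉ E.walls ∧ tile (Ψ p) = τ := by
  have hloc : ∀ t, ∃ τ : deck π, ∀ᶠ p in 𝓝 ((t, 0) : ℝ × ℝ), 0 < p.2 →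
      Ψ p ∉ E.walls ∧ tile (Ψ p) = τ := by
    intro t
    obtain ⟨ε, hε, hball⟩ := Metric.mem_nhds_iff.1 (hline t)
    have hmem : ∀ p : ℝ × ℝ, p ∈ Metric.ball ((t, 0) : ℝ × ℝ) ε → 0 < p.2 → Ψ p ∉ E.walls :=
      fun p hp hp0 => hball hp hp0.ne'
    have hconv : IsPreconnected (Metric.ball ((t, 0) : ℝ × ℝ) ε ∩ {p | 0 < p.2}) := by
      refine ((convex_ball _ _).inter ?_).isPreconnected
      exact (convex_Ioi (0 : ℝ)).linear_preimage (LinearMap.snd ℝ ℝ ℝ)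
    have hq : ((t, ε / 2) : ℝ × ℝ) ∈ Metric.ball ((t, 0) : ℝ × ℝ) ε ∩ {p | 0 < p.2} := by
      refine ⟨?_, half_pos hε⟩
      rw [Metric.mem_ball, Prod.dist_eq, dist_self, Real.dist_eq, sub_zero,
        abs_of_pos (half_pos hε), max_eq_right (half_pos hε).le]
      exact half_lt_self hε
    refine ⟨tile (Ψ (t, ε / 2)), ?_⟩
    filter_upwards [Metric.ball_mem_nhds _ hε] with p hp hp0
    refine ⟨hmem p hp hp0, ?_⟩
    refine IsPreconnected.eq_of_eventually_eq hconv (f := fun p => tile (Ψ p)) ?_ ⟨hp, hp0⟩ hq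
    rintro p' ⟨hp', hp0'⟩
    exact nhdsWithin_le_nhds
      (Ψ.continuous.continuousAt.eventually (htile _ (hmem p' hp' hp0')))
  choose τ hτ using hloc
  -- For nearby base points on the line the half-neighbourhoods overlap, so the label found there is
  -- locally constant along the line.
  have hconst : ∀ t, τ t = τ 0 := by
    intro t
    refine IsPreconnected.eq_of_eventually_eq isPreconnected_univ (f := τ) ?_ (mem_univ _)
      (mem_univ _)
    intro t _
    rw [nhdsWithin_univ]
    have h1 : ∀ᶠ t' in 𝓝 t, ∀ᶠ p in 𝓝 ((t', 0) : ℝ × ℝ), 0 < p.2 →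
        Ψ p ∉ E.walls ∧ tile (Ψ p) = τ t :=
      (by fun_prop : Continuous fun t' : ℝ => ((t', 0) : ℝ × ℝ)).continuousAt.eventually
        (eventually_eventually_nhds.2 (hτ t))
    filter_upwards [h1] with t' ht'
    have h2 := (hτ t').and ht'
    have hcont : Tendsto (fun s : ℝ => ((t', s) : ℝ × ℝ)) (𝓝[>] 0) (𝓝 (t', 0)) :=
      (by fun_prop : Continuous fun s : ℝ => ((t', s) : ℝ × ℝ)).continuousAt.tendsto.mono_left
        nhdsWithin_le_nhds
    obtain ⟨s, hs, hs0⟩ := ((hcont.eventually h2).and self_mem_nhdsWithin).exists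
    rw [← (hs.1 hs0).2, ← (hs.2 hs0).2]
  exact ⟨τ 0, fun t => by simpa only [hconst t] using hτ t⟩

theorem exists_tiling [T2Space Y] (hcov : IsCoveringMap π) (hsurj : Function.Surjective π)
    (hiso : ∀ φ : deck π, Isometry (φ • · : ℍ → ℍ)) (E : CutSystem π) : Nonempty E.Tiling := by
  choose c hc hinj hrange using E.isArc
  have hclosed := isClosed_walls_of_lines hcov hiso hc hrange
  obtain ⟨tile, h1, h2, h3, h4⟩ := exists_tile hcov hsurj hclosed
  choose Ψ hΨ using fun i => exists_lineCoordinates (hc i).1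
  -- By local finiteness, a point of the line has a neighbourhood that meets only walls through that
  -- point, and distinct lifts of arcs are disjoint.
  have hline : ∀ i t, ∀ᶠ p in 𝓝 ((t, 0) : ℝ × ℝ), p.2 ≠ 0 → Ψ i p ∉ E.walls := by
    intro i t
    have hnhd := (locallyFinite_lines hcov hiso hc).iInter_compl_mem_nhds
      (isClosed_range_line hiso hc) (c i t)
    rw [← hΨ] at hnhd
    filter_upwards [(Ψ i).continuous.continuousAt.preimage_mem_nhds hnhd] with p hp hp0 hw
    obtain ⟨p', t', ht'⟩ := (mem_walls_iff hcov hrange).1 hw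
    have hx : c i t ∈ range fun t => p'.2 • c p'.1 t := by
      by_contra hx
      have := mem_iInter₂.1 hp p' (by rwa [hΨ])
      exact this ⟨t', ht'⟩
    obtain ⟨t'', ht''⟩ := hx
    have := (smul_line_inj hcov hinj hrange (p := p') (p' := (i, 1)) (t' := t)
      (by rw [one_smul]; exact ht'')).1
    subst this
    change (1 : deck π) • c i t' = _ at ht'
    rw [one_smul, ← hΨ] at ht'
    have := (Ψ i).injective ht'
    rw [← this] at hp0
    exact hp0 rfl
  choose pos hpos using fun i => exists_side_tile (Ψ i) h3 (hline i)
  -- Reflecting the second coordinate reduces the negative side to the positive one.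
  let flip : ℝ × ℝ ≃ₜ ℝ × ℝ := (Homeomorph.refl ℝ).prodCongr (Homeomorph.neg ℝ)
  have hflip : ∀ t : ℝ, flip (t, 0) = (t, 0) := fun t => by simp [flip]
  have hflip2 : ∀ p, (flip p).2 = -p.2 := fun p => rfl
  have hff : ∀ p, flip (flip p) = p := fun p => Prod.ext rfl (neg_neg p.2)
  have htend : ∀ t, Tendsto flip (𝓝 ((t, 0) : ℝ × ℝ)) (𝓝 (t, 0)) := fun t => by
    simpa only [hflip] using flip.continuous.continuousAt.tendsto (x := (t, 0))
  choose neg hneg using fun i => exists_side_tile (flip.trans (Ψ i)) h3 (fun t => by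
    filter_upwards [(htend t).eventually (hline i t)] with p hp hp0
    exact hp (by rw [hflip2]; exact neg_ne_zero.2 hp0))
  refine ⟨⟨Ψ, ?_, ?_, ?_, hclosed, tile, h1, h2, h3, h4, pos, neg, hpos, ?_⟩⟩
  · simpa only [hΨ] using hc
  · simpa only [hΨ] using hinj
  · simpa only [hΨ] using hrange
  · intro i t
    filter_upwards [(htend t).eventually (hneg i t)] with p hp hp0
    have := hp (by rw [hflip2]; linarith)
    simpa only [Homeomorph.trans_apply, hff] using this

end Existence

end CutSystem

end Tiling

/-! ### The Cayley graph as the dual tree of the tiling -/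

section TilingTree

variable {Y : Type*} [TopologicalSpace Y] {S : Set Y} {π : C(ℍ, (Sᶜ : Set Y))}

namespace CutSystem

namespace Tiling

variable {E : CutSystem π} (T : E.Tiling)

/-- The second coordinate with respect to the line `p.2 • axis p.1`. Its sign distinguishes the two
sides of the line. -/
def side (p : Fin E.k × deck π) (w : ℍ) : ℝ := ((T.chart p.1).symm (p.2⁻¹ • w)).2

/-- The lift of the arc `p.1` obtained from the axis of its chart by the deck transformation
`p.2`. -/
def line (p : Fin E.k × deck π) (t : ℝ) : ℍ := p.2 • T.chart p.1 (t, 0)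

lemma continuous_side (p : Fin E.k × deck π) : Continuous (T.side p) :=
  continuous_snd.comp ((T.chart p.1).symm.continuous.comp (continuous_const_smul p.2⁻¹))

@[simp] lemma side_smul_chart (p : Fin E.k × deck π) (q : ℝ × ℝ) :
    T.side p (p.2 • T.chart p.1 q) = q.2 := by
  simp [side]

lemma side_eq_zero_iff (p : Fin E.k × deck π) (w : ℍ) :
    T.side p w = 0 ↔ w ∈ range (T.line p) := by
  constructor
  · intro h
    refine ⟨((T.chart p.1).symm (p.2⁻¹ • w)).1, ?_⟩
    have : (((T.chart p.1).symm (p.2⁻¹ • w)).1, (0 : ℝ)) = (T.chart p.1).symm (p.2⁻¹ • w) :=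
      Prod.ext rfl h.symm
    rw [line, this, Homeomorph.apply_symm_apply, smul_inv_smul]
  · rintro ⟨t, rfl⟩
    exact T.side_smul_chart p (t, 0)

lemma mem_walls (hcov : IsCoveringMap π) {w : ℍ} :
    w ∈ E.walls ↔ ∃ p t, T.line p t = w :=
  mem_walls_iff (c := fun i t => T.chart i (t, 0)) hcov T.range_eq

lemma line_inj (hcov : IsCoveringMap π) {p p' : Fin E.k × deck π} {t t' : ℝ}
    (h : T.line p t = T.line p' t') : p = p' ∧ t = t' :=
  smul_line_inj (c := fun i t => T.chart i (t, 0)) hcov T.injective T.range_eq h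

lemma line_mem_walls (hcov : IsCoveringMap π) (p : Fin E.k × deck π) (t : ℝ) :
    T.line p t ∈ E.walls := (T.mem_walls hcov).2 ⟨p, t, rfl⟩

lemma side_ne_zero (hcov : IsCoveringMap π) (p : Fin E.k × deck π) {w : ℍ} (hw : w ∉ E.walls) :
    T.side p w ≠ 0 := by
  rw [Ne, side_eq_zero_iff]
  rintro ⟨t, rfl⟩
  exact hw (T.line_mem_walls hcov p t)

lemma side_pos_iff_of_isPreconnected (p : Fin E.k × deck π) {s : Set ℍ} (hs : IsPreconnected s)
    (h0 : ∀ w ∈ s, T.side p w ≠ 0) {w w' : ℍ} (hw : w ∈ s) (hw' : w' ∈ s) :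
    0 < T.side p w ↔ 0 < T.side p w' := by
  refine Eq.to_iff (IsPreconnected.eq_of_eventually_eq hs (f := fun w => 0 < T.side p w) ?_ hw hw')
  intro x hx
  refine nhdsWithin_le_nhds ?_
  have hc := (T.continuous_side p).continuousAt (x := x)
  rcases (h0 x hx).lt_or_gt with h | h
  · filter_upwards [hc.eventually (gt_mem_nhds h)] with y hy
    exact propext ⟨fun h' => absurd h' hy.not_gt, fun h' => absurd h' h.not_gt⟩
  · filter_upwards [hc.eventually (lt_mem_nhds h)] with y hy
    exact propext ⟨fun _ => h, fun _ => hy⟩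

/-- The tile labelled `v` lies on the positive side of the line `p`. -/
def IsPos (p : Fin E.k × deck π) (v : deck π) : Prop := 0 < T.side p (v • E.z)

lemma smul_base_notMem (v : deck π) : v • E.z ∉ E.walls := fun h =>
  E.notMem (smul_mem_walls.1 h)

lemma tile_smul_base (v : deck π) : T.tile (v • E.z) = v := by
  rw [T.tile_smul _ _ E.notMem, T.tile_base, mul_one]

lemma side_pos_iff (hcov : IsCoveringMap π) (p : Fin E.k × deck π) {w : ℍ} (hw : w ∉ E.walls) :
    0 < T.side p w ↔ T.IsPos p (T.tile w) :=
  T.side_pos_iff_of_isPreconnected p (T.isPathConnected (T.tile w)).isConnected.isPreconnected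
    (fun _ h => T.side_ne_zero hcov p h.1) ⟨hw, rfl⟩ ⟨smul_base_notMem _, T.tile_smul_base _⟩

lemma eventually_line (p : Fin E.k × deck π) (t : ℝ) : ∀ᶠ w in 𝓝 (T.line p t),
    (0 < T.side p w → w ∉ E.walls ∧ T.tile w = p.2 * T.pos p.1) ∧
      (T.side p w < 0 → w ∉ E.walls ∧ T.tile w = p.2 * T.neg p.1) := by
  have htend : Tendsto (fun w => (T.chart p.1).symm (p.2⁻¹ • w)) (𝓝 (T.line p t))
      (𝓝 (t, 0)) := by
    have := ((T.chart p.1).symm.continuous.comp (continuous_const_smul p.2⁻¹)).tendsto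
      (T.line p t)
    simpa [line, Function.comp_def] using this
  have key : ∀ w v, (T.chart p.1 ((T.chart p.1).symm (p.2⁻¹ • w)) ∉ E.walls ∧
      T.tile (T.chart p.1 ((T.chart p.1).symm (p.2⁻¹ • w))) = v) →
      w ∉ E.walls ∧ T.tile w = p.2 * v := by
    rintro w v ⟨h1, h2⟩
    rw [Homeomorph.apply_symm_apply] at h1 h2
    refine ⟨fun h => h1 (smul_mem_walls.2 h), ?_⟩
    rw [← h2, ← T.tile_smul _ _ h1, smul_inv_smul]
  filter_upwards [htend.eventually (T.pos_spec p.1 t), htend.eventually (T.neg_spec p.1 t)]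
    with w h1 h2
  exact ⟨fun h => key w _ (h1 h), fun h => key w _ (h2 h)⟩

lemma eventually_normal_pos (p : Fin E.k × deck π) (t : ℝ) : ∀ᶠ s in 𝓝[>] (0 : ℝ),
    p.2 • T.chart p.1 (t, s) ∉ E.walls ∧
      T.tile (p.2 • T.chart p.1 (t, s)) = p.2 * T.pos p.1 := by
  have hc : Continuous fun s : ℝ => p.2 • T.chart p.1 (t, s) :=
    ((T.chart p.1).continuous.comp (by fun_prop)).const_smul p.2
  filter_upwards [nhdsWithin_le_nhds (hc.continuousAt.eventually (T.eventually_line p t)),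
    self_mem_nhdsWithin] with s hs h0
  exact hs.1 (by rw [side_smul_chart]; exact h0)

lemma eventually_normal_neg (p : Fin E.k × deck π) (t : ℝ) : ∀ᶠ s in 𝓝[<] (0 : ℝ),
    p.2 • T.chart p.1 (t, s) ∉ E.walls ∧
      T.tile (p.2 • T.chart p.1 (t, s)) = p.2 * T.neg p.1 := by
  have hc : Continuous fun s : ℝ => p.2 • T.chart p.1 (t, s) :=
    ((T.chart p.1).continuous.comp (by fun_prop)).const_smul p.2
  filter_upwards [nhdsWithin_le_nhds (hc.continuousAt.eventually (T.eventually_line p t)),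
    self_mem_nhdsWithin] with s hs h0
  exact hs.2 (by rw [side_smul_chart]; exact h0)

lemma tendsto_normal (p : Fin E.k × deck π) (t : ℝ) :
    Tendsto (fun s : ℝ => p.2 • T.chart p.1 (t, s)) (𝓝 0) (𝓝 (T.line p t)) :=
  (((T.chart p.1).continuous.comp (by fun_prop : Continuous fun s : ℝ => (t, s))).const_smul
    p.2).tendsto 0

lemma isPos_pos (hcov : IsCoveringMap π) (p : Fin E.k × deck π) :
    T.IsPos p (p.2 * T.pos p.1) := by
  obtain ⟨s, ⟨h1, h2⟩, h3⟩ := ((T.eventually_normal_pos p 0).and self_mem_nhdsWithin).exists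
  rw [← h2, ← T.side_pos_iff hcov p h1, side_smul_chart]
  exact h3

lemma not_isPos_neg (hcov : IsCoveringMap π) (p : Fin E.k × deck π) :
    ¬ T.IsPos p (p.2 * T.neg p.1) := by
  obtain ⟨s, ⟨h1, h2⟩, h3⟩ := ((T.eventually_normal_neg p 0).and self_mem_nhdsWithin).exists
  rw [← h2, ← T.side_pos_iff hcov p h1, side_smul_chart]
  exact not_lt.2 (le_of_lt h3)

/-- The two tiles adjacent to a line are not separated by any other line. -/
lemma isPos_iff_of_ne (hcov : IsCoveringMap π) {p p' : Fin E.k × deck π} (hne : p ≠ p') :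
    T.IsPos p (p'.2 * T.pos p'.1) ↔ T.IsPos p (p'.2 * T.neg p'.1) := by
  -- A point of the line `p'` is off `p`, so points on either side of `p'` near it are on the same
  -- side of `p`.
  have h0 : T.side p (T.line p' 0) ≠ 0 := by
    rw [Ne, side_eq_zero_iff]
    rintro ⟨t, ht⟩
    exact hne (T.line_inj hcov ht).1
  have hev : ∀ᶠ w in 𝓝 (T.line p' 0), (0 < T.side p w ↔ 0 < T.side p (T.line p' 0)) := by
    have hc := (T.continuous_side p).continuousAt (x := T.line p' 0)
    rcases h0.lt_or_gt with h | h
    · filter_upwards [hc.eventually (gt_mem_nhds h)] with y hy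
      exact ⟨fun h' => absurd h' hy.not_gt, fun h' => absurd h' h.not_gt⟩
    · filter_upwards [hc.eventually (lt_mem_nhds h)] with y hy
      exact ⟨fun _ => h, fun _ => hy⟩
  have hev' := (T.tendsto_normal p' 0).eventually hev
  obtain ⟨s, ⟨h1, h2⟩, h3⟩ :=
    ((T.eventually_normal_pos p' 0).and (nhdsWithin_le_nhds hev')).exists
  obtain ⟨s', ⟨h1', h2'⟩, h3'⟩ :=
    ((T.eventually_normal_neg p' 0).and (nhdsWithin_le_nhds hev')).exists
  rw [← h2, ← h2', ← T.side_pos_iff hcov p h1, ← T.side_pos_iff hcov p h1', h3, h3']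

/-- The deck transformation that crosses the axis of the chart `i`, from its negative side. -/
def gen (i : Fin E.k) : deck π := (T.neg i)⁻¹ * T.pos i

/-- A lift of the arc `i` that is a geodesic is one of the lines of the tiling. -/
lemma exists_range_line_eq (hcov : IsCoveringMap π) {i : Fin E.k} {l : Set ℍ}
    (hl : l ∈ idealLines π) (hπl : π '' l = E.arc i) : ∃ u, l = range (T.line (i, u)) := by
  obtain ⟨c, hc, rfl⟩ := hl
  have hex : ∀ s, ∃ (u : deck π) (t : ℝ), T.line (i, u) t = c s := by
    intro s
    have : π (c s) ∈ E.arc i := hπl ▸ ⟨c s, ⟨s, rfl⟩, rfl⟩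
    rw [← T.range_eq] at this
    obtain ⟨t, ht⟩ := this
    obtain ⟨φ, hφ⟩ := exists_deck_smul_eq hcov ht
    exact ⟨φ, t, hφ⟩
  choose u τ hu using hex
  -- Near a point of a line all wall points belong to that line, so the label of the line that
  -- contains `c s` is locally constant in `s`.
  have hloc : ∀ s, ∀ᶠ s' in 𝓝 s, u s' = u s := by
    intro s
    have h1 := T.eventually_line (i, u s) (τ s)
    rw [hu] at h1
    filter_upwards [hc.1.continuous.continuousAt.eventually h1] with s' hs'
    have hw : c s' ∈ E.walls := by rw [← hu]; exact T.line_mem_walls hcov _ _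
    have h0 : T.side (i, u s) (c s') = 0 := by
      by_contra hne
      rcases lt_or_gt_of_ne hne with h | h
      · exact (hs'.2 h).1 hw
      · exact (hs'.1 h).1 hw
    obtain ⟨t, ht⟩ := (T.side_eq_zero_iff _ _).1 h0
    rw [← hu] at ht
    exact (congrArg Prod.snd (T.line_inj hcov ht).1).symm
  have hconst : ∀ s, u s = u 0 := fun s =>
    IsPreconnected.eq_of_eventually_eq isPreconnected_univ
      (fun s _ => nhdsWithin_le_nhds (hloc s)) (mem_univ _) (mem_univ _)
  refine ⟨u 0, Subset.antisymm ?_ ?_⟩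
  · rintro _ ⟨s, rfl⟩
    exact ⟨τ s, by rw [← hconst s, hu]⟩
  · rintro _ ⟨t, rfl⟩
    have : π (T.line (i, u 0) t) ∈ π '' range c := by
      rw [hπl, ← T.range_eq, line, proj_smul]
      exact ⟨t, rfl⟩
    obtain ⟨_, ⟨s, rfl⟩, hs⟩ := this
    rw [← hu s, hconst s, line, line, proj_smul, proj_smul] at hs
    have := T.injective i hs
    exact ⟨s, by rw [← hu s, hconst s, ← this]⟩

lemma tile_eq_of_forall_notMem {J : Set I} (hJ : IsPreconnected J) {α : I → ℍ}
    (hα : Continuous α) (h : ∀ s ∈ J, α s ∉ E.walls) {s s' : I} (hs : s ∈ J) (hs' : s' ∈ J) :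
    T.tile (α s) = T.tile (α s') :=
  IsPreconnected.eq_of_eventually_eq hJ (f := fun s => T.tile (α s))
    (fun x hx => nhdsWithin_le_nhds
      (hα.continuousAt.eventually (T.eventually_tile_eq _ (h x hx)))) hs hs'

/-- Before its only meeting with the walls the lift stays in the tile `1`, afterwards in the tile
`φ`. Both tiles are adjacent to the same line, and they differ because the crossing is genuine, so
`φ` is the quotient of the two labels in one order or the other. -/
lemma eq_of_isDual (hcov : IsCoveringMap π) {i : Fin E.k} {γ : E.group} (h : E.IsDual i γ) :
    γ = E.deckClass (T.gen i) ∨ γ = E.deckClass (T.gen i)⁻¹ := by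
  obtain ⟨w, hw, α, t, l, rfl, hl, hπl, hαt, hmeet, hcomp⟩ := h
  have hmeet : ∀ s, α s ∈ E.walls ↔ s = t := hmeet
  obtain ⟨φ, rfl⟩ := exists_deck_smul_eq hcov hw.symm
  rw [← E.deckClass_eq φ α hw]
  obtain ⟨u, rfl⟩ := T.exists_range_line_eq hcov hl hπl
  obtain ⟨t₀, ht₀⟩ := hαt
  have hz : E.z ∉ E.walls := E.notMem
  have ht0 : t ≠ 0 := by
    rintro rfl
    exact hz (by simpa using (hmeet 0).2 rfl)
  have ht1 : t ≠ 1 := by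
    rintro rfl
    exact smul_base_notMem φ (by simpa using (hmeet 1).2 rfl)
  have hφ : φ ≠ 1 := by
    rintro rfl
    rw [one_smul] at hcomp
    refine hcomp (mem_connectedComponentIn ?_)
    rintro ⟨t', ht'⟩
    exact hz (ht' ▸ T.line_mem_walls hcov _ _)
  have hev : ∀ᶠ s in 𝓝 t, α s ∉ E.walls →
      T.tile (α s) = u * T.pos i ∨ T.tile (α s) = u * T.neg i := by
    have h1 := T.eventually_line (i, u) t₀
    rw [ht₀] at h1
    filter_upwards [α.continuous.continuousAt.eventually h1] with s hs hsw
    rcases lt_or_gt_of_ne (T.side_ne_zero hcov (i, u) hsw) with h | h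
    · exact Or.inr (hs.2 h).2
    · exact Or.inl (hs.1 h).2
  have h1 : (1 : deck π) = u * T.pos i ∨ 1 = u * T.neg i := by
    have : (𝓝[<] t).NeBot := nhdsLT_neBot_of_exists_lt ⟨0, lt_of_le_of_ne t.2.1 (Ne.symm ht0)⟩
    obtain ⟨s, hs, hst⟩ := ((hev.filter_mono nhdsWithin_le_nhds).and
      (self_mem_nhdsWithin : Iio t ∈ 𝓝[<] t)).exists
    have hoff : ∀ s ∈ Iio t, α s ∉ E.walls := fun s hs hw => (ne_of_lt hs) ((hmeet s).1 hw)
    have h2 := T.tile_eq_of_forall_notMem isPreconnected_Iio α.continuous hoff hst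
      (lt_of_le_of_ne t.2.1 (Ne.symm ht0) : (0 : I) < t)
    rw [α.source, T.tile_base] at h2
    rw [← h2]
    exact hs (hoff s hst)
  have h2 : φ = u * T.pos i ∨ φ = u * T.neg i := by
    have : (𝓝[>] t).NeBot := nhdsGT_neBot_of_exists_gt ⟨1, lt_of_le_of_ne t.2.2 ht1⟩
    obtain ⟨s, hs, hst⟩ := ((hev.filter_mono nhdsWithin_le_nhds).and
      (self_mem_nhdsWithin : Ioi t ∈ 𝓝[>] t)).exists
    have hoff : ∀ s ∈ Ioi t, α s ∉ E.walls := fun s hs hw => (ne_of_gt hs) ((hmeet s).1 hw)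
    have h2 := T.tile_eq_of_forall_notMem isPreconnected_Ioi α.continuous hoff hst
      (lt_of_le_of_ne t.2.2 ht1 : t < (1 : I))
    rw [α.target, T.tile_smul_base] at h2
    rw [← h2]
    exact hs (hoff s hst)
  have key : φ = T.gen i ∨ φ = (T.gen i)⁻¹ := by
    rcases h1 with h1 | h1 <;> rcases h2 with h2 | h2
    · exact absurd (h2.trans h1.symm) hφ
    · right
      rw [h2, eq_inv_of_mul_eq_one_left h1.symm, gen, mul_inv_rev, inv_inv]
    · left
      rw [h2, eq_inv_of_mul_eq_one_left h1.symm, gen]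
    · exact absurd (h2.trans h1.symm) hφ
  rcases key with rfl | rfl
  · exact Or.inl rfl
  · exact Or.inr rfl

/-- Leave the line along a normal segment and continue inside the tile `v`. The sign of `δ` selects
the side. -/
lemma exists_path_of_eventually (hcov : IsCoveringMap π) (p : Fin E.k × deck π) {v : deck π}
    {δ : ℝ} (h : ∀ s ∈ Ioc (0 : ℝ) 1, p.2 • T.chart p.1 (0, δ * s) ∉ E.walls ∧
      T.tile (p.2 • T.chart p.1 (0, δ * s)) = v) :
    ∃ α : Path (T.line p 0) (v • E.z), ∀ s, α s ∈ E.walls ↔ s = 0 := by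
  let α : Path (T.line p 0) (p.2 • T.chart p.1 (0, δ * 1)) :=
    { toFun := fun s => p.2 • T.chart p.1 (0, δ * s)
      continuous_toFun := ((T.chart p.1).continuous.comp (by fun_prop)).const_smul p.2
      source' := by simp [line]
      target' := by simp }
  have hα : ∀ s, α s ∈ E.walls ↔ s = 0 := by
    intro s
    constructor
    · intro hs
      by_contra hne
      exact (h s ⟨lt_of_le_of_ne s.2.1 fun h => hne (Subtype.ext h.symm), s.2.2⟩).1 hs
    · rintro rfl
      rw [α.source]
      exact T.line_mem_walls hcov p 0
  have hjoin := (T.isPathConnected v).joinedIn _ (h 1 (by simp)) (v • E.z)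
    ⟨smul_base_notMem v, T.tile_smul_base v⟩
  refine ⟨α.trans hjoin.somePath, fun s => ?_⟩
  rw [Path.trans_apply]
  split_ifs with hs
  · rw [hα, Subtype.ext_iff, Subtype.ext_iff]
    simp
  · refine iff_of_false (hjoin.somePath_mem _).1 ?_
    rintro rfl
    exact hs (by simp)

lemma exists_path_pos (hcov : IsCoveringMap π) (p : Fin E.k × deck π) :
    ∃ α : Path (T.line p 0) ((p.2 * T.pos p.1) • E.z), ∀ s, α s ∈ E.walls ↔ s = 0 := by
  obtain ⟨δ, hδ, hball⟩ := mem_nhdsGT_iff_exists_Ioc_subset.1 (T.eventually_normal_pos p 0)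
  refine T.exists_path_of_eventually hcov p (δ := δ) fun s hs => hball ⟨mul_pos hδ hs.1, ?_⟩
  have := mul_le_mul_of_nonneg_left hs.2 (le_of_lt hδ)
  simpa using this

lemma exists_path_neg (hcov : IsCoveringMap π) (p : Fin E.k × deck π) :
    ∃ α : Path (T.line p 0) ((p.2 * T.neg p.1) • E.z), ∀ s, α s ∈ E.walls ↔ s = 0 := by
  obtain ⟨δ, hδ, hball⟩ := mem_nhdsLT_iff_exists_Ico_subset.1 (T.eventually_normal_neg p 0)
  have hδ : δ < 0 := hδ
  refine T.exists_path_of_eventually hcov p (δ := δ) fun s hs => hball ⟨?_, ?_⟩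
  · nlinarith [hs.2]
  · exact mul_neg_of_neg_of_pos hδ hs.1

lemma isDual_gen (hcov : IsCoveringMap π) (hiso : ∀ φ : deck π, Isometry (φ • · : ℍ → ℍ))
    (i : Fin E.k) : E.IsDual i (E.deckClass (T.gen i)) := by
  -- The translate of the axis whose negative side is the tile `1`, which contains `E.z`; its
  -- positive side is then the tile `T.gen i`.
  set p : Fin E.k × deck π := (i, (T.neg i)⁻¹) with hp
  obtain ⟨α, hα⟩ := T.exists_path_pos hcov p
  obtain ⟨α', hα'⟩ := T.exists_path_neg hcov p
  have hz : (p.2 * T.neg p.1) • E.z = E.z := by rw [hp, inv_mul_cancel, one_smul]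
  let β : Path E.z (T.gen i • E.z) := (α'.symm.trans α).cast hz.symm rfl
  refine ⟨T.gen i • E.z, proj_smul _ _, β, ⟨1 / 2, by norm_num, by norm_num⟩, range (T.line p),
    (E.deckClass_eq _ _ _).symm, ⟨T.line p, (T.ideal i).smul hiso _, rfl⟩, ?_, ?_, ?_, ?_⟩
  · rw [← range_comp, ← T.range_eq]
    congr 1
    funext t
    exact proj_smul _ _
  · refine ⟨0, ?_⟩
    have : β ⟨1 / 2, by norm_num, by norm_num⟩ =
      (α'.symm.trans α) ⟨1 / 2, by norm_num, by norm_num⟩ := rfl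
    rw [this, Path.trans_apply, dif_pos (by norm_num)]
    simp
  · intro s
    change (α'.symm.trans α) s ∈ E.walls ↔ _
    rw [Path.trans_apply]
    split_ifs with hs
    · refine (hα' (unitInterval.symm _)).trans ?_
      rw [Subtype.ext_iff, Subtype.ext_iff, unitInterval.coe_symm_eq]
      constructor
      · intro h
        have : 1 - 2 * (s : ℝ) = 0 := h
        linarith
      · intro h
        change 1 - 2 * (s : ℝ) = 0
        rw [h]; norm_num
    · rw [hα, Subtype.ext_iff, Subtype.ext_iff]
      constructor
      · intro h
        have : 2 * (s : ℝ) - 1 = 0 := h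
        change (s : ℝ) = 1 / 2
        linarith
      · intro h
        exact absurd (le_of_eq h) hs
  · intro hmem
    have h1 := T.side_pos_iff_of_isPreconnected p
      (isPreconnected_connectedComponentIn (F := (range (T.line p))ᶜ) (x := E.z))
      (fun w hw h0 => connectedComponentIn_subset _ _ hw ((T.side_eq_zero_iff p w).1 h0))
      hmem (mem_connectedComponentIn fun h =>
        T.side_ne_zero hcov p E.notMem ((T.side_eq_zero_iff _ _).2 h))
    have h2 : 0 < T.side p (T.gen i • E.z) := T.isPos_pos hcov p
    have h3 := T.not_isPos_neg hcov p
    rw [IsPos, hz] at h3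
    exact h3 (h1.1 h2)

/-- Edges of the Cayley graph correspond to lines of the tiling: right multiplication by `T.gen i`
or its inverse moves to the tile across a lift of the arc `i`. -/
lemma cayley_adj_iff (hcov : IsCoveringMap π) (hiso : ∀ φ : deck π, Isometry (φ • · : ℍ → ℍ))
    (a b : deck π) : E.cayley.Adj (E.deckClass a) (E.deckClass b) ↔
      ∃ p : Fin E.k × deck π, (a = p.2 * T.neg p.1 ∧ b = p.2 * T.pos p.1) ∨
        (a = p.2 * T.pos p.1 ∧ b = p.2 * T.neg p.1) := by
  have hinj := E.deckClass_injective hcov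
  have hgen : ∀ (i : Fin E.k) (a b : deck π), b = a * T.gen i →
      ∃ p : Fin E.k × deck π, a = p.2 * T.neg p.1 ∧ b = p.2 * T.pos p.1 := by
    rintro i a b rfl
    exact ⟨(i, a * (T.neg i)⁻¹), by simp, by simp [gen, mul_assoc]⟩
  rw [cayley, SimpleGraph.mulCayley_adj']
  constructor
  · rintro ⟨hne, γ, ⟨i, hγ⟩, h⟩
    have hcase : b = a * T.gen i ∨ a = b * T.gen i := by
      rcases T.eq_of_isDual hcov hγ with rfl | rfl
      · rw [← E.deckClass_mul, ← E.deckClass_mul] at h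
        exact h.imp (fun h => (hinj h).symm) fun h => hinj h
      · rw [← E.deckClass_mul, ← E.deckClass_mul] at h
        rcases h with h | h
        · right; rw [← hinj h]; simp
        · left; rw [hinj h]; simp
    rcases hcase with h | h
    · obtain ⟨p, h1, h2⟩ := hgen i a b h
      exact ⟨p, Or.inl ⟨h1, h2⟩⟩
    · obtain ⟨p, h1, h2⟩ := hgen i b a h
      exact ⟨p, Or.inr ⟨h2, h1⟩⟩
  · have hmul : ∀ p : Fin E.k × deck π, E.deckClass (p.2 * T.neg p.1) * E.deckClass (T.gen p.1) =
        E.deckClass (p.2 * T.pos p.1) := fun p => by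
      rw [← E.deckClass_mul]; simp [gen, mul_assoc]
    have hne : ∀ p : Fin E.k × deck π,
        E.deckClass (p.2 * T.neg p.1) ≠ E.deckClass (p.2 * T.pos p.1) := fun p h =>
      T.not_isPos_neg hcov p (hinj h ▸ T.isPos_pos hcov p)
    rintro ⟨p, ⟨rfl, rfl⟩ | ⟨rfl, rfl⟩⟩
    · exact ⟨hne p, _, ⟨p.1, T.isDual_gen hcov hiso p.1⟩, Or.inl (hmul p)⟩
    · exact ⟨(hne p).symm, _, ⟨p.1, T.isDual_gen hcov hiso p.1⟩, Or.inr (hmul p).symm⟩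

/-- Sending a point to the component of its tile is locally constant on the connected space `ℍ`. On
a wall the positive tile is used; the tile across is adjacent to it, hence in the same component. -/
lemma cayley_preconnected (T : E.Tiling) (hcov : IsCoveringMap π)
    (hiso : ∀ φ : deck π, Isometry (φ • · : ℍ → ℍ)) : E.cayley.Preconnected := by
  classical
  let comp : deck π → E.cayley.ConnectedComponent := fun v =>
    E.cayley.connectedComponentMk (E.deckClass v)
  have hadj : ∀ p : Fin E.k × deck π, comp (p.2 * T.neg p.1) = comp (p.2 * T.pos p.1) := fun p =>
    SimpleGraph.ConnectedComponent.sound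
      ((T.cayley_adj_iff hcov hiso _ _).2 ⟨p, Or.inl ⟨rfl, rfl⟩⟩).reachable
  have hex : ∀ w : {w // w ∈ E.walls}, ∃ p t, T.line p t = w.1 := fun w =>
    (T.mem_walls hcov).1 w.2
  choose P τ hP using hex
  let κ : ℍ → E.cayley.ConnectedComponent := fun w =>
    if h : w ∈ E.walls then comp ((P ⟨w, h⟩).2 * T.pos (P ⟨w, h⟩).1) else comp (T.tile w)
  have hκ : ∀ w, w ∉ E.walls → κ w = comp (T.tile w) := fun w h => dif_neg h
  have hκ' : ∀ p t, κ (T.line p t) = comp (p.2 * T.pos p.1) := by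
    intro p t
    have hw := T.line_mem_walls hcov p t
    have h1 : κ (T.line p t) = _ := dif_pos hw
    rw [h1, (T.line_inj hcov (hP ⟨_, hw⟩)).1]
  have hloc : ∀ w, ∀ᶠ w' in 𝓝 w, κ w' = κ w := by
    intro w
    by_cases hw : w ∈ E.walls
    · obtain ⟨p, t, rfl⟩ := (T.mem_walls hcov).1 hw
      filter_upwards [T.eventually_line p t] with w' hw'
      rw [hκ']
      rcases lt_trichotomy (T.side p w') 0 with h | h | h
      · rw [hκ _ (hw'.2 h).1, (hw'.2 h).2, hadj]
      · obtain ⟨t', rfl⟩ := (T.side_eq_zero_iff p w').1 h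
        rw [hκ']
      · rw [hκ _ (hw'.1 h).1, (hw'.1 h).2]
    · filter_upwards [T.eventually_tile_eq w hw, T.isClosed_walls.isOpen_compl.mem_nhds hw]
        with w' h1 h2
      rw [hκ _ hw, hκ _ h2, h1]
  intro x y
  obtain ⟨a, rfl⟩ := E.deckClass_surjective hcov x
  obtain ⟨b, rfl⟩ := E.deckClass_surjective hcov y
  have h := IsPreconnected.eq_of_eventually_eq isPreconnected_univ (f := κ)
    (fun x _ => nhdsWithin_le_nhds (hloc x)) (mem_univ (a • E.z)) (mem_univ (b • E.z))
  rw [hκ _ (smul_base_notMem a), hκ _ (smul_base_notMem b), T.tile_smul_base,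
    T.tile_smul_base] at h
  exact SimpleGraph.ConnectedComponent.exact h

/-- Every edge is a bridge: its ends lie on different sides of the line `p` that it crosses, while
any other edge crosses another line and keeps the side of `p`. -/
lemma cayley_isAcyclic (T : E.Tiling) (hcov : IsCoveringMap π)
    (hiso : ∀ φ : deck π, Isometry (φ • · : ℍ → ℍ)) : E.cayley.IsAcyclic := by
  rw [SimpleGraph.isAcyclic_iff_forall_adj_isBridge]
  intro x y hxy
  obtain ⟨a, rfl⟩ := E.deckClass_surjective hcov x
  obtain ⟨b, rfl⟩ := E.deckClass_surjective hcov y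
  obtain ⟨p, hp⟩ := (T.cayley_adj_iff hcov hiso a b).1 hxy
  have hsep : ¬ (T.IsPos p a ↔ T.IsPos p b) := by
    have h1 := T.isPos_pos hcov p
    have h2 := T.not_isPos_neg hcov p
    rcases hp with ⟨rfl, rfl⟩ | ⟨rfl, rfl⟩ <;> tauto
  rw [SimpleGraph.isBridge_iff]
  intro hreach
  have key : ∀ x y, (E.cayley \ SimpleGraph.fromEdgeSet
      {s(E.deckClass a, E.deckClass b)}).Reachable x y → ∀ a' b', E.deckClass a' = x →
      E.deckClass b' = y → (T.IsPos p a' ↔ T.IsPos p b') := by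
    rintro x y ⟨walk⟩
    induction walk with
    | nil =>
      intro a' b' ha hb
      rw [E.deckClass_injective hcov (ha.trans hb.symm)]
    | @cons u v w huv _ ih =>
      rintro a' b' rfl rfl
      obtain ⟨v', rfl⟩ := E.deckClass_surjective hcov v
      rw [← ih v' b' rfl rfl]
      rw [SimpleGraph.sdiff_adj, SimpleGraph.fromEdgeSet_adj] at huv
      obtain ⟨p', hp'⟩ := (T.cayley_adj_iff hcov hiso a' v').1 huv.1
      have hne : p ≠ p' := by
        rintro rfl
        refine huv.2 ⟨?_, huv.1.ne⟩
        rw [mem_singleton_iff, Sym2.eq_iff]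
        rcases hp with ⟨rfl, rfl⟩ | ⟨rfl, rfl⟩ <;> rcases hp' with ⟨rfl, rfl⟩ | ⟨rfl, rfl⟩ <;>
          simp
      have := T.isPos_iff_of_ne hcov hne
      rcases hp' with ⟨rfl, rfl⟩ | ⟨rfl, rfl⟩ <;> tauto
  exact hsep (key _ _ hreach a b rfl rfl)

theorem cayley_isTree (T : E.Tiling) (hcov : IsCoveringMap π)
    (hiso : ∀ φ : deck π, Isometry (φ • · : ℍ → ℍ)) : E.cayley.IsTree where
  connected := { preconnected := T.cayley_preconnected hcov hiso, nonempty := ⟨1⟩ }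
  isAcyclic := T.cayley_isAcyclic hcov hiso

lemma finite_setOf_isDual (T : E.Tiling) (hcov : IsCoveringMap π) : {γ | ∃ i, E.IsDual i γ}.Finite := by
  refine ((finite_range fun i => E.deckClass (T.gen i)).union
    (finite_range fun i => E.deckClass (T.gen i)⁻¹)).subset ?_
  rintro γ ⟨i, h⟩
  exact (T.eq_of_isDual hcov h).imp (fun h => ⟨i, h.symm⟩) fun h => ⟨i, h.symm⟩

end Tiling

end CutSystem

end TilingTree

/-! ### Word metrics and local finiteness -/

section WordMetric

lemma dist_map_le {V W : Type*} {G : SimpleGraph V} {H : SimpleGraph W} (hG : G.Connected)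
    (hH : H.Connected) {f : V → W} {K : ℕ} (h : ∀ u v, G.Adj u v → H.dist (f u) (f v) ≤ K)
    (u v : V) : H.dist (f u) (f v) ≤ K * G.dist u v := by
  obtain ⟨p, hp⟩ := hG.exists_walk_length_eq_dist u v
  rw [← hp]
  clear hp
  induction p with
  | nil => simp
  | cons huv p ih =>
    rw [SimpleGraph.Walk.length_cons, Nat.mul_add, Nat.mul_one, add_comm]
    exact hH.dist_triangle.trans (add_le_add (h _ _ huv) ih)

variable {Γ Γ' : Type*} [Group Γ] [Group Γ'] {s : Set Γ} {s' : Set Γ'}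

lemma dist_mulCayley_mul_left_le (hs : (SimpleGraph.mulCayley s).Connected) (g a b : Γ) :
    (SimpleGraph.mulCayley s).dist (g * a) (g * b) ≤ (SimpleGraph.mulCayley s).dist a b := by
  simpa using dist_map_le hs hs (f := (g * ·)) (K := 1) (fun u v h => by
    rw [SimpleGraph.dist_eq_one_iff_adj.2 (SimpleGraph.mulCayley_adj_mul_iff_right.2 h)]) a b

/-- By left invariance each generator, wherever it is applied, moves the image by at most the
largest word length of the images of generators. -/
lemma exists_dist_map_le (hs : (SimpleGraph.mulCayley s).Connected)
    (hs' : (SimpleGraph.mulCayley s').Connected) (hfin : s.Finite) (β : Γ →* Γ') :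
    ∃ K : ℕ, ∀ u v, (SimpleGraph.mulCayley s').dist (β u) (β v) ≤
      K * (SimpleGraph.mulCayley s).dist u v := by
  obtain ⟨K, hK⟩ := (hfin.image fun g => (SimpleGraph.mulCayley s').dist 1 (β g)).bddAbove
  have key : ∀ u, ∀ g ∈ s, (SimpleGraph.mulCayley s').dist (β u) (β (u * g)) ≤ K := by
    intro u g hg
    have := dist_mulCayley_mul_left_le hs' (β u) 1 (β g)
    rw [mul_one, ← map_mul] at this
    exact this.trans (hK ⟨g, hg, rfl⟩)
  refine ⟨K, dist_map_le hs hs' fun u v h => ?_⟩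
  obtain ⟨-, g, hg, rfl | rfl⟩ := (SimpleGraph.mulCayley_adj' s u v).1 h
  · exact key u g hg
  · rw [SimpleGraph.dist_comm]
    exact key v g hg

lemma finite_neighbors_mulCayley (hfin : s.Finite) (u : Γ) :
    {v | (SimpleGraph.mulCayley s).Adj u v}.Finite := by
  refine ((hfin.image (u * ·)).union (hfin.image fun g => u * g⁻¹)).subset fun v h => ?_
  obtain ⟨-, g, hg, rfl | rfl⟩ := (SimpleGraph.mulCayley_adj' s u v).1 h
  · exact Or.inl ⟨g, hg, rfl⟩
  · exact Or.inr ⟨g, hg, by simp⟩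

lemma finite_ball_mulCayley (hs : (SimpleGraph.mulCayley s).Connected) (hfin : s.Finite) (u : Γ)
    (n : ℕ) : {v | (SimpleGraph.mulCayley s).dist u v ≤ n}.Finite := by
  induction n with
  | zero =>
    refine (finite_singleton u).subset fun v hv => ?_
    exact (hs.dist_eq_zero_iff.1 (Nat.le_zero.1 hv)).symm
  | succ n ih =>
    refine ((finite_singleton u).union
      (ih.biUnion fun y _ => finite_neighbors_mulCayley hfin y)).subset fun v hv => ?_
    by_cases hne : v = u
    · exact Or.inl hne
    · obtain ⟨y, hy, hd⟩ := exists_adj_dist_of_ne hs hne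
      have hv : (SimpleGraph.mulCayley s).dist u v ≤ n + 1 := hv
      exact Or.inr (mem_biUnion (x := y)
        (show (SimpleGraph.mulCayley s).dist u y ≤ n by omega) hy)

/-- The points of the metric Cayley graph on the edges at the vertex `1` form a compact set. -/
lemma exists_isCompact_star (hfin : s.Finite) :
    ∃ K : Set (Realization (SimpleGraph.mulCayley s)), IsCompact K ∧
      ∀ x : Realization (SimpleGraph.mulCayley s), 0 < x.1 1 → x ∈ K := by
  set G := SimpleGraph.mulCayley s with hG
  have hcont : ∀ (u v : Γ) (h : G.Adj u v), Continuous (edgePoint h) := by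
    intro u v h
    refine Continuous.subtype_mk (f := fun t : Icc (0 : ℝ) 1 => edgeFun u v t) ?_ _
    unfold edgeFun
    fun_prop
  have hfin' : {p : Γ × Γ | G.Adj p.1 p.2 ∧ (p.1 = 1 ∨ p.2 = 1)}.Finite := by
    have h1 := finite_neighbors_mulCayley hfin 1
    refine (((finite_singleton (1 : Γ)).prod h1).union (h1.prod (finite_singleton (1 : Γ)))).subset
      ?_
    rintro ⟨u, v⟩ ⟨h, rfl | rfl⟩
    · exact Or.inl ⟨rfl, h⟩
    · exact Or.inr ⟨h.symm, rfl⟩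
  refine ⟨{vertex G 1} ∪ ⋃ p ∈ {p : Γ × Γ | G.Adj p.1 p.2 ∧ (p.1 = 1 ∨ p.2 = 1)},
    {x | ∃ (h : G.Adj p.1 p.2) (t : Icc (0 : ℝ) 1), edgePoint h t = x}, ?_, ?_⟩
  · refine isCompact_singleton.union (hfin'.isCompact_biUnion ?_)
    rintro ⟨u, v⟩ ⟨h, -⟩
    convert! isCompact_range (hcont u v h)
    ext x
    exact ⟨fun ⟨_, t, ht⟩ => ⟨t, ht⟩, fun ⟨t, ht⟩ => ⟨h, t, ht⟩⟩
  · intro x hx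
    rcases x.eq_vertex_or_edgePoint with ⟨u, rfl⟩ | ⟨u, v, h, t, rfl⟩
    · rw [pos_vertex_iff] at hx
      exact Or.inl (by rw [hx]; rfl)
    · refine Or.inr (mem_biUnion (x := (u, v)) ⟨h, ?_⟩ ⟨h, t, rfl⟩)
      exact (pos_edgePoint hx).imp Eq.symm Eq.symm

end WordMetric

/-! ### Half-planes seen from two cut systems -/

section Comparison

variable {Y : Type*} [TopologicalSpace Y] {S : Set Y} {π : C(ℍ, (Sᶜ : Set Y))}

lemma exists_isCompact_isPreconnected_superset {K : Set ℍ} (hK : IsCompact K) :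
    ∃ L, IsCompact L ∧ IsPreconnected L ∧ K ⊆ L := by
  let Φ := axisCoordinates 1 one_ne_zero
  obtain ⟨R, hR⟩ := (hK.image Φ.symm.continuous).isBounded.subset_closedBall 0
  refine ⟨Φ '' Metric.closedBall 0 R, (isCompact_closedBall 0 R).image Φ.continuous,
    (convex_closedBall 0 R).isPreconnected.image _ Φ.continuous.continuousOn, fun x hx => ?_⟩
  exact ⟨Φ.symm x, hR ⟨x, hx, rfl⟩, Φ.apply_symm_apply x⟩

namespace CutSystem

/-- Translating a nearby vertex to `1` moves `x` into the compact star of `1`, and equivariance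
carries this to `ℍ`. -/
lemma exists_isCompact_of_isEquivariantEmbedding {E : CutSystem π}
    (hfin : {γ | ∃ i, E.IsDual i γ}.Finite)
    {ι : Realization E.cayley → ℍ} (hι : E.IsEquivariantEmbedding ι) :
    ∃ K : Set ℍ, IsCompact K ∧ ∀ (x : Realization E.cayley) (φ : deck π),
      E.deckClass φ = near x → ∃ y ∈ K, φ • y = ι x := by
  obtain ⟨K, hK, hstar⟩ := exists_isCompact_star hfin
  refine ⟨ι '' K, hK.image hι.1.continuous, fun x φ hφ => ?_⟩
  set u := E.deckClass φ with hu
  have hx : x = translate u (translate u⁻¹ x) := by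
    refine Subtype.ext (funext fun v => ?_)
    simp [translate]
  refine ⟨_, ⟨translate u⁻¹ x, hstar _ ?_, rfl⟩, ?_⟩
  · change 0 < x.1 (u⁻¹⁻¹ * 1)
    rw [inv_inv, mul_one, hφ]
    exact near_pos x
  · rw [deck_smul_def, ← hι.2 u φ.1 (E.isDeck_deckClass φ), ← hx]

variable {E₁ E₂ : CutSystem π}

/-- Two rays at finite Hausdorff distance, one in each of the graphs of two cut systems, are
eventually in the same half-planes. -/
lemma eventually_mem_of_fellow [T2Space Y] (hcov : IsCoveringMap π)
    (hiso : ∀ φ : deck π, Isometry (φ • · : ℍ → ℍ))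
    (h₁ : E₁.cayley.Connected) (h₂ : E₂.cayley.Connected)
    (hfin₁ : {γ | ∃ i, E₁.IsDual i γ}.Finite) (hfin₂ : {γ | ∃ i, E₂.IsDual i γ}.Finite)
    {ι₁ : Realization E₁.cayley → ℍ} (hι₁ : E₁.IsEquivariantEmbedding ι₁)
    {ι₂ : Realization E₂.cayley → ℍ} (hι₂ : E₂.IsEquivariantEmbedding ι₂)
    {β : E₁.group → E₂.group} (hβ : ∀ φ, β (E₁.deckClass φ) = E₂.deckClass φ) {K : ℕ}
    (hβK : ∀ u v, E₂.cayley.dist (β u) (β v) ≤ K * E₁.cayley.dist u v)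
    {r : GeodesicRay E₁.cayley} {r' : GeodesicRay E₂.cayley} (h : Fellow β r r')
    {P : Set ℍ} (hP : P ∈ halfPlanes π)
    (hr : ∃ T : ℝ≥0, 0 < T ∧ ∀ t, T < t → ι₁ (r.toFun t) ∈ P) :
    ∃ T : ℝ≥0, 0 < T ∧ ∀ t, T < t → ι₂ (r'.toFun t) ∈ P := by
  obtain ⟨_, ⟨c, hc, rfl⟩, x, hx, rfl⟩ := hP
  obtain ⟨K₁, hK₁, hιK₁⟩ := exists_isCompact_of_isEquivariantEmbedding hfin₁ hι₁
  obtain ⟨K₂, hK₂, hιK₂⟩ := exists_isCompact_of_isEquivariantEmbedding hfin₂ hι₂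
  obtain ⟨C, hC⟩ := h.exists_late h₁ h₂ hβK
  have hF : {ψ : deck π | E₂.cayley.dist 1 (E₂.deckClass ψ) ≤ C}.Finite :=
    (finite_ball_mulCayley h₂ hfin₂ 1 C).preimage (E₂.deckClass_injective hcov).injOn
  -- Relative to the tile `φ` near the first ray, the companion on the second ray has label `φ * ψ`
  -- for one of finitely many `ψ`. So one compact set `L` serves for both rays, and it is enlarged
  -- to be connected.
  obtain ⟨L, hL, hLconn, hKL⟩ := exists_isCompact_isPreconnected_superset
    (hK₁.union (hF.isCompact_biUnion fun ψ _ => hK₂.image (continuous_const_smul ψ)))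
  -- These are the vertices `φ` for which `φ • L` meets the bounding geodesic, rewritten as `φ⁻¹ •
  -- c` meeting `L`. There are finitely many, so the ray eventually avoids them.
  have hbad : (E₁.deckClass '' {φ : deck π | φ⁻¹ ∈ {ψ : deck π | ∃ t, ψ • c t ∈ L}}).Finite :=
    ((hc.finite_setOf_smul_mem hcov hiso hL).preimage inv_injective.injOn).image _
  obtain ⟨T₁, hT₁⟩ := r.eventually_notMem hbad
  obtain ⟨T, -, hT⟩ := hr
  obtain ⟨N, hN⟩ := hC (max T T₁)
  refine ⟨N + 1, by positivity, fun s hs => ?_⟩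
  obtain ⟨t, ht, hd⟩ := hN s (lt_of_le_of_lt le_self_add hs)
  have hP := hT t ((le_max_left _ _).trans_lt ht)
  have hgood := hT₁ t ((le_max_right _ _).trans_lt ht)
  obtain ⟨φ, hφ⟩ := E₁.deckClass_surjective hcov (near (r.toFun t))
  obtain ⟨φ', hφ'⟩ := E₂.deckClass_surjective hcov (near (r'.toFun s))
  obtain ⟨y, hy, hyι⟩ := hιK₁ _ φ hφ
  obtain ⟨y', hy', hyι'⟩ := hιK₂ _ φ' hφ'
  rw [← hφ, ← hφ', hβ] at hd
  have hψ : E₂.cayley.dist 1 (E₂.deckClass (φ⁻¹ * φ')) ≤ C := by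
    have h3 := dist_mulCayley_mul_left_le h₂ (E₂.deckClass φ⁻¹) (E₂.deckClass φ) (E₂.deckClass φ')
    rw [← E₂.deckClass_mul, ← E₂.deckClass_mul, inv_mul_cancel] at h3
    have h4 : E₂.deckClass 1 = 1 := map_one (E₂.deckEquiv hcov)
    rw [h4] at h3
    exact h3.trans hd
  have hdisj : (φ • ·) '' L ⊆ (range c)ᶜ := by
    rintro _ ⟨v, hv, rfl⟩ ⟨t', ht'⟩
    refine hgood ⟨φ, ⟨t', ?_⟩, hφ⟩
    rw [ht', inv_smul_smul]
    exact hv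
  have hconn : IsPreconnected ((φ • ·) '' L) :=
    hLconn.image _ (continuous_const_smul φ).continuousOn
  have hmem : ι₁ (r.toFun t) ∈ (φ • ·) '' L := ⟨y, hKL (Or.inl hy), hyι⟩
  have hmem' : ι₂ (r'.toFun s) ∈ (φ • ·) '' L := by
    refine ⟨(φ⁻¹ * φ') • y', hKL (Or.inr (mem_biUnion (x := φ⁻¹ * φ') hψ ⟨y', hy', rfl⟩)), ?_⟩
    change φ • (φ⁻¹ * φ') • y' = _
    rw [smul_smul, mul_inv_cancel_left, hyι']
  rw [connectedComponentIn_eq hP]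
  exact hconn.subset_connectedComponentIn hmem hdisj hmem'

lemma mem_halfPlaneNhd_inl {E : CutSystem π} {ι : Realization E.cayley → ℍ} {P : Set ℍ} {x : ℍ} :
    (Sum.inl x : E.Hat ι) ∈ E.halfPlaneNhd ι P ↔ x ∈ P := by
  constructor
  · rintro (⟨y, hy, h⟩ | ⟨ξ, -, h⟩)
    · exact Sum.inl.inj h ▸ hy
    · nomatch h
  · exact fun h => Or.inl ⟨x, h, rfl⟩

lemma mem_halfPlaneNhd_inr {E : CutSystem π} {ι : Realization E.cayley → ℍ} {P : Set ℍ}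
    {ξ : GromovBoundary E.cayley} :
    (Sum.inr ξ : E.Hat ι) ∈ E.halfPlaneNhd ι P ↔ ∃ r : GeodesicRay E.cayley, r.class = ξ ∧
      ∃ T : ℝ≥0, 0 < T ∧ ∀ t, T < t → ι (r.toFun t) ∈ P := by
  constructor
  · rintro (⟨y, -, h⟩ | ⟨ζ, hζ, h⟩)
    · nomatch h
    · exact Sum.inr.inj h ▸ hζ
  · exact fun h => Or.inr ⟨ξ, h, rfl⟩

/-- The generators of the first topology are exactly the preimages of those of the second, so the
topology is induced; with bijectivity this is a homeomorphism. -/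
lemma isHomeomorph_glue {ι₁ : Realization E₁.cayley → ℍ} {ι₂ : Realization E₂.cayley → ℍ}
    {b : GromovBoundary E₁.cayley → GromovBoundary E₂.cayley} (hb : Function.Bijective b)
    (h : ∀ P ∈ halfPlanes π, glue ι₁ ι₂ b ⁻¹' E₂.halfPlaneNhd ι₂ P = E₁.halfPlaneNhd ι₁ P) :
    IsHomeomorph (glue ι₁ ι₂ b) := by
  have hbij : Function.Bijective (glue ι₁ ι₂ b) :=
    ⟨Function.injective_id.sumMap hb.1, Function.surjective_id.sumMap hb.2⟩
  rw [isHomeomorph_iff_isEmbedding_surjective]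
  refine ⟨⟨⟨?_⟩, hbij.1⟩, hbij.2⟩
  have hinl : ∀ O : Set ℍ, glue ι₁ ι₂ b ⁻¹' (Sum.inl '' O) = (Sum.inl '' O : Set (E₁.Hat ι₁)) := by
    intro O
    ext x
    rcases x with x | x
    · change (Sum.inl x : ℍ ⊕ _) ∈ Sum.inl '' O ↔ (Sum.inl x : ℍ ⊕ _) ∈ Sum.inl '' O
      simp
    · change (Sum.inr (b x) : ℍ ⊕ _) ∈ Sum.inl '' O ↔ (Sum.inr x : ℍ ⊕ _) ∈ Sum.inl '' O
      simp
  refine Eq.trans ?_ induced_generateFrom_eq.symm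
  change TopologicalSpace.generateFrom _ = _
  congr 1
  rw [image_union]
  congr 1
  · ext U
    constructor
    · rintro ⟨O, hO, rfl⟩
      exact ⟨_, ⟨O, hO, rfl⟩, hinl O⟩
    · rintro ⟨_, ⟨O, hO, rfl⟩, rfl⟩
      exact ⟨O, hO, hinl O⟩
  · ext U
    constructor
    · rintro ⟨P, hP, rfl⟩
      exact ⟨_, ⟨P, hP, rfl⟩, h P hP⟩
    · rintro ⟨_, ⟨P, hP, rfl⟩, rfl⟩
      exact ⟨P, hP, h P hP⟩

end CutSystem

end Comparison

end IdealBoundary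

end

/-! ### The change of choices -/

theorem proposition4p1 {Y : Type*} [TopologicalSpace Y] [T2Space Y] [CompactSpace Y]
    [ConnectedSpace Y] [ChartedSpace ℂ Y] [IsManifold 𝓘(ℂ) ω Y]
    (S : Set Y) (hS : S.Finite) (hS' : S.Nonempty)
    (π : C(ℍ, (Sᶜ : Set Y))) (hcov : IsCoveringMap π) (hsurj : Function.Surjective π)
    (hhol : MDifferentiable 𝓘(ℂ) 𝓘(ℂ) (fun w : ℍ => (π w : Y)))
    (E₁ E₂ : IdealBoundary.CutSystem π)
    (ι₁ : IdealBoundary.Realization E₁.cayley → ℍ) (hι₁ : E₁.IsEquivariantEmbedding ι₁)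
    (ι₂ : IdealBoundary.Realization E₂.cayley → ℍ) (hι₂ : E₂.IsEquivariantEmbedding ι₂)
    (c : Path E₁.z E₂.z)
    (f : IdealBoundary.Realization E₁.cayley → IdealBoundary.Realization E₂.cayley)
    (hf : IdealBoundary.IsGeodesicExtension (IdealBoundary.CutSystem.change E₁ E₂ c) f) :
    ∃ b : IdealBoundary.GromovBoundary E₁.cayley → IdealBoundary.GromovBoundary E₂.cayley,
      IdealBoundary.IsBoundaryMap f b ∧
        IsHomeomorph (IdealBoundary.CutSystem.glue ι₁ ι₂ b) := by
  have hiso := IdealBoundary.deck_isometry hcov hhol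
  obtain ⟨T₁⟩ := IdealBoundary.CutSystem.exists_tiling hcov hsurj hiso E₁
  obtain ⟨T₂⟩ := IdealBoundary.CutSystem.exists_tiling hcov hsurj hiso E₂
  have ht₁ := T₁.cayley_isTree hcov hiso
  have ht₂ := T₂.cayley_isTree hcov hiso
  have hfin₁ := T₁.finite_setOf_isDual hcov
  have hfin₂ := T₂.finite_setOf_isDual hcov
  set β := IdealBoundary.CutSystem.change E₁ E₂ c
  have hβ : ∀ φ, β (E₁.deckClass φ) = E₂.deckClass φ :=
    IdealBoundary.CutSystem.change_deckClass c
  have hβ' : ∀ φ, β.symm (E₂.deckClass φ) = E₁.deckClass φ := fun φ => by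
    rw [← hβ, MulEquiv.symm_apply_apply]
  -- Finite generating sets make the isomorphism and its inverse Lipschitz; below, the maximum
  -- serves as a common constant.
  obtain ⟨K₁, hK₁⟩ := IdealBoundary.exists_dist_map_le ht₁.connected ht₂.connected hfin₁
    β.toMonoidHom
  obtain ⟨K₂, hK₂⟩ := IdealBoundary.exists_dist_map_le ht₂.connected ht₁.connected hfin₂
    β.symm.toMonoidHom
  have h₁ : ∀ u v, E₂.cayley.dist (β u) (β v) ≤ max K₁ K₂ * E₁.cayley.dist u v := fun u v =>
    (hK₁ u v).trans (Nat.mul_le_mul_right _ (le_max_left _ _))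
  have h₂ : ∀ u v, E₁.cayley.dist (β.symm u) (β.symm v) ≤ max K₁ K₂ * E₂.cayley.dist u v :=
    fun u v => (hK₂ u v).trans (Nat.mul_le_mul_right _ (le_max_right _ _))
  have h₂' : ∀ u v, E₁.cayley.dist u v ≤ max K₁ K₂ * E₂.cayley.dist (β u) (β v) := fun u v => by
    simpa only [MulEquiv.symm_apply_apply] using h₂ (β u) (β v)
  obtain ⟨b, hb, hspec⟩ := IdealBoundary.exists_boundary_bijection ht₁ ht₂ β.toEquiv h₁ h₂'
  refine ⟨b, fun r r' => ?_, IdealBoundary.CutSystem.isHomeomorph_glue hb fun P hP => ?_⟩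
  · rw [hspec]
    refine (hf.hausdorff_iff ht₂.connected (K := max K₁ K₂) (fun u v huv => ?_) r r').symm
    have := h₁ u v
    rwa [SimpleGraph.dist_eq_one_iff_adj.2 huv, mul_one] at this
  · ext x
    rcases x with x | ξ
    · change (Sum.inl x : E₂.Hat ι₂) ∈ E₂.halfPlaneNhd ι₂ P ↔ _
      exact IdealBoundary.CutSystem.mem_halfPlaneNhd_inl.trans
        IdealBoundary.CutSystem.mem_halfPlaneNhd_inl.symm
    · obtain ⟨r, rfl⟩ : ∃ r : IdealBoundary.GeodesicRay E₁.cayley, r.class = ξ := Quot.exists_rep ξ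
      change (Sum.inr (b r.class) : E₂.Hat ι₂) ∈ E₂.halfPlaneNhd ι₂ P ↔ _
      refine IdealBoundary.CutSystem.mem_halfPlaneNhd_inr.trans
        (Iff.trans ?_ IdealBoundary.CutSystem.mem_halfPlaneNhd_inr.symm)
      constructor
      · rintro ⟨r', hr', hT⟩
        have hfel := (hspec r r').1 hr'.symm
        exact ⟨r, rfl, IdealBoundary.CutSystem.eventually_mem_of_fellow hcov hiso ht₂.connected
          ht₁.connected hfin₂ hfin₁ hι₂ hι₁ hβ' h₂ (hfel.symm h₂') hP hT⟩
      -- Membership in `U_P` is witnessed by some ray `s` of the class, not necessarily `r`, so the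
      -- companion ray is built from `s`.
      · rintro ⟨s, hs, hT⟩
        obtain ⟨r', hr'⟩ := IdealBoundary.exists_fellow ht₁.connected ht₂ h₁ h₂' s
        refine ⟨r', ?_, IdealBoundary.CutSystem.eventually_mem_of_fellow hcov hiso ht₁.connected
          ht₂.connected hfin₁ hfin₂ hι₁ hι₂ hβ h₁ hr' hP hT⟩
        rw [← hs]
        exact ((hspec s r').2 hr').symm
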